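/- Setting. Synthetic differential geometry in a model: $\mathcal E$ is a cartesian closed category with finite limits (for instance a topos), $k$ a commutative ring, and $R$ (the line) a commutative $k$-algebra object of $\mathcal E$. "Elements" are generalized elements, that is, maps $T\to X$ from an arbitrary object $T$ of $\mathcal E$. A Weil algebra is a commutative augmented $k$-algebra $W$ that is finite and free as a $k$-module and has nilpotent augmentation ideal; its spectrum $\operatorname{Spec}_R W$ is the object of $k$-algebra homomorphisms $W\to R$, and the objects of this form are called infinitesimal. $R$ is assumed to satisfy the Kock–Lawvere axiom: for every Weil algebra $W$ the canonical map $W\otimes_k R\to R^{\operatorname{Spec}_R W}$ is an isomorphism. An object $M$ is microlinear if, for every finite cocone of infinitesimal objects (with infinitesimal vertex) that $R^{(-)}$ sends to a limit cone, $M^{(-)}$ also sends it to a limit cone. A Lie group is a group object that is microlinear. A Lie algebra is an $R$-module object $L$ with a bilinear bracket satisfying the antisymmetric law and the Jacobi identity that is microlinear and Euclidean: every $f\colon D\to L$ is of the form $f(d)=a+d\,b$ for unique $a,b\in L$. Here $D_n=\{d\in R\mid d^{n+1}=0\}$ and $D=D_1$. The Lie algebra $\mathbf{Lie}(G)$ of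 a Lie group $G$ is $\{x\in G^{D}\mid x(0)=1\}$ with $(x+y)(d)=x(d)\,y(d)$, $(r x)(d)=x(rd)$ and the bracket determined by $[x,y](d_1d_2)=x(d_1)\,y(d_2)\,x(-d_1)\,y(-d_2)$ for $d_1,d_2\in D$; it is a Lie algebra. For a Lie group $G$, the subgroup $(G^{D_n})_1=\{f\in G^{D_n}\mid f(0)=1\}$ of $G^{D_n}$, with the pointwise operations, is again a Lie group; for a Lie algebra $\mathfrak g$, the subalgebra $(\mathfrak g^{D_n})_0=\{f\in\mathfrak g^{D_n}\mid f(0)=0\}$ of $\mathfrak g^{D_n}$, with the pointwise operations, is again a Lie algebra. Statement. Let $G$ be a Lie group with Lie algebra $\mathfrak g=\mathbf{Lie}(G)$, and let $n\ge 0$. Then $$\mathbf{Lie}\bigl((G^{D_n})_1\bigr)=(\mathfrak g^{D_n})_0$$ as Lie algebras, under the identification given by the exponential law $(G^{D_n})^{D}=G^{D_n\times D}=(G^{D})^{D_n}$. That is, exchanging the two variables, $h\mapsto e(h)$ with $e(h)(d)(x)=h(x)(d)$ for $d\in D_n$ and $x\in D$, defines an isomorphism of Lie algebras (an isomorphism of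 objects of $\mathcal E$ preserving addition, the action of $R$ and the bracket) $e\colon \mathbf{Lie}\bigl((G^{D_n})_1\bigr)\to(\mathfrak g^{D_n})_0$. -/

import Mathlib

open CategoryTheory Limits MonoidalCategory CartesianMonoidalCategory
open scoped MonObj AddMonObj RingObj CommRingObj TensorProduct

universe w v u

namespace SDG

set_option linter.unusedSectionVars false

noncomputable section

variable {E : Type u} [Category.{v} E] [CartesianMonoidalCategory E] [BraidedCategory E]

/-! ### The line object -/

/-- Restriction of `R`-valued functions along a change of stage. -/
def pull (R : E) [CommRingObj R] {S T : E} (s : S ⟶ T) : (T ⟶ R) →+* (S ⟶ R) where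
  toFun f := s ≫ f
  map_one' := by simp
  map_zero' := by simp
  map_mul' _ _ := MonObj.comp_mul _ _ _
  map_add' _ _ := AddMonObj.comp_add _ _ _

/-- A commutative ring object `R` is a `k`-algebra object if its ring of global elements is
a `k`-algebra. -/
class AlgObj (k : Type w) [CommRing k] (R : E) [CommRingObj R] where
  unitHom : k →+* (𝟙_ E ⟶ R)

/-- The induced `k`-algebra structure on the ring of generalized elements of `R` at stage `T`. -/
instance algHom (k : Type w) [CommRing k] (R : E) [CommRingObj R] [AlgObj k R] (T : E) :
    Algebra k (T ⟶ R) :=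
  ((pull R (toUnit T)).comp AlgObj.unitHom).toAlgebra

/-- Change of stage, as a homomorphism of `k`-algebras. -/
def pullAlg (k : Type w) [CommRing k] (R : E) [CommRingObj R] [AlgObj k R] {S T : E} (s : S ⟶ T) :
    (T ⟶ R) →ₐ[k] (S ⟶ R) :=
  { pull R s with
    commutes' := fun c => by
      change s ≫ toUnit T ≫ AlgObj.unitHom c = toUnit S ≫ AlgObj.unitHom c
      rw [← Category.assoc, toUnit_unique (s ≫ toUnit T) (toUnit S)] }

/-! ### Weil algebras, infinitesimal objects, the Kock-Lawvere axiom -/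

/-- Weil algebras over `k`: commutative augmented `k`-algebras, finite and free as modules, with
nilpotent augmentation ideal. -/
structure IsWeil (k W : Type w) [CommRing k] [CommRing W] [Algebra k W] : Prop where
  finite : Module.Finite k W
  free : Module.Free k W
  aug : ∃ π : W →ₐ[k] k, IsNilpotent (RingHom.ker π)

/-- `X` is the spectrum of `W` in the line `R`, that is, the object of `k`-algebra homomorphisms
from `W` to `R`. -/
structure Spec (k : Type w) [CommRing k] (R : E) [CommRingObj R] [AlgObj k R]
    (W : Type w) [CommRing W] [Algebra k W] (X : E) where
  gen : W →ₐ[k] (X ⟶ R)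
  bij : ∀ T : E, Function.Bijective fun f : T ⟶ X => (pullAlg k R f).comp gen

/-- The infinitesimal objects: the spectra of Weil algebras. -/
def IsInfinitesimal (k : Type w) [CommRing k] (R : E) [CommRingObj R] [AlgObj k R] (X : E) : Prop :=
  ∃ (W : Type w) (_ : CommRing W) (_ : Algebra k W), IsWeil k W ∧ Nonempty (Spec k R W X)

/-- The comparison map `W ⊗ R ⟶ R ^ X` of the spectrum `X` of `W`, at stage `T`. -/
def comparison (k : Type w) [CommRing k] (R : E) [CommRingObj R] [AlgObj k R]
    {W : Type w} [CommRing W] [Algebra k W] {X : E} (s : Spec k R W X) (T : E) :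
    W ⊗[k] (T ⟶ R) →ₐ[k] (X ⊗ T ⟶ R) :=
  Algebra.TensorProduct.productMap ((pullAlg k R (fst X T)).comp s.gen) (pullAlg k R (snd X T))

/-- The (general) Kock-Lawvere axiom: `W ⊗ R ⟶ R ^ Spec W` is an isomorphism for every Weil
algebra `W`. -/
class KockLawvere (k : Type w) [CommRing k] (R : E) [CommRingObj R] [AlgObj k R] : Prop where
  bijective : ∀ (W : Type w) [CommRing W] [Algebra k W], IsWeil k W →
    ∀ (X : E) (s : Spec k R W X) (T : E), Function.Bijective (comparison k R s T)

/-! ### Microlinearity -/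

/-- `M` perceives the cocone `c` as a colimit: `M ^ c` is a limit cone (the condition is spelled
out on generalized elements, a map `X ⊗ T ⟶ M` being an element of `M ^ X` at stage `T`). -/
def Perceives {J : Type} [SmallCategory J] (M : E) {F : J ⥤ E} (c : Cocone F) : Prop :=
  ∀ (T : E) (f : ∀ j, F.obj j ⊗ T ⟶ M), (∀ ⦃i j : J⦄ (a : i ⟶ j), F.map a ▷ T ≫ f j = f i) →
    ∃! g : c.pt ⊗ T ⟶ M, ∀ j, c.ι.app j ▷ T ≫ g = f j

/-- `M` is microlinear: it perceives as a colimit every finite cocone of infinitesimal objects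
that the line `R` perceives as a colimit. -/
def Microlinear (k : Type w) [CommRing k] (R : E) [CommRingObj R] [AlgObj k R] (M : E) : Prop :=
  ∀ (J : Type) [SmallCategory J] [FinCategory J] (F : J ⥤ E) (c : Cocone F),
    (∀ j, IsInfinitesimal k R (F.obj j)) → IsInfinitesimal k R c.pt →
      Perceives R c → Perceives M c

/-- Lie groups: group objects that are microlinear. -/
structure LieGrp (k : Type w) [CommRing k] (R : E) [CommRingObj R] [AlgObj k R] where
  X : E
  [grp : GrpObj X]
  microlinear : Microlinear k R X

attribute [instance] LieGrp.grp

/-! ### The objects `D_n` -/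

section

variable {R : E} [CommRingObj R]

lemma comp_pow' {S T : E} (s : S ⟶ T) (f : T ⟶ R) (m : ℕ) : s ≫ f ^ m = (s ≫ f) ^ m :=
  map_pow (pull R s) f m

lemma comp_zero' {S T : E} (s : S ⟶ T) : s ≫ (0 : T ⟶ R) = 0 := map_zero (pull R s)

lemma comp_one' {S T : E} (s : S ⟶ T) : s ≫ (1 : T ⟶ R) = 1 := map_one (pull R s)

lemma comp_mul' {S T : E} (s : S ⟶ T) (f g : T ⟶ R) : s ≫ (f * g) = (s ≫ f) * (s ≫ g) :=
  map_mul (pull R s) f g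

lemma comp_add' {S T : E} (s : S ⟶ T) (f g : T ⟶ R) : s ≫ (f + g) = (s ≫ f) + (s ≫ g) :=
  map_add (pull R s) f g

end

variable [HasFiniteLimits E]

/-- `D_n = {x ∈ R | x ^ (n + 1) = 0}`. -/
def D (R : E) [CommRingObj R] (n : ℕ) : E :=
  equalizer ((𝟙 R : R ⟶ R) ^ (n + 1)) 0

/-- The inclusion `D_n ⟶ R`. -/
def incl (R : E) [CommRingObj R] (n : ℕ) : D R n ⟶ R := equalizer.ι _ _

section

variable {R : E} [CommRingObj R]

lemma incl_pow {T : E} {n : ℕ} (d : T ⟶ D R n) : (d ≫ incl R n) ^ (n + 1) = 0 := by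
  have h : d ≫ incl R n ≫ (𝟙 R : R ⟶ R) ^ (n + 1) = d ≫ incl R n ≫ 0 :=
    d ≫= equalizer.condition ((𝟙 R : R ⟶ R) ^ (n + 1)) 0
  rwa [comp_pow', comp_zero', comp_zero', comp_pow', Category.comp_id] at h

/-- The element of `D_n` given by an element of `R` whose `(n+1)`-st power vanishes. -/
def toD {T : E} {n : ℕ} (r : T ⟶ R) (h : r ^ (n + 1) = 0) : T ⟶ D R n :=
  equalizer.lift r (by rw [comp_pow', comp_zero', Category.comp_id, h])

@[simp] lemma toD_incl {T : E} {n : ℕ} (r : T ⟶ R) (h : r ^ (n + 1) = 0) :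
    toD r h ≫ incl R n = r := equalizer.lift_ι _ _

lemma D_ext {T : E} {n : ℕ} {d d' : T ⟶ D R n} (h : d ≫ incl R n = d' ≫ incl R n) : d = d' :=
  equalizer.hom_ext h

end

/-- The base point `0` of `D_n`. -/
def zeroD (R : E) [CommRingObj R] (n : ℕ) : 𝟙_ E ⟶ D R n := toD 0 (by simp)

/-! ### Spaces of pointed maps -/

variable [MonoidalClosed E]

/-- For pointed objects `(U, u₀)` and `(X, x₀)`, the subobject `{f ∈ X ^ U | f(u₀) = x₀}` of the
exponential `X ^ U`. -/
def Ptd {U X : E} (u₀ : 𝟙_ E ⟶ U) (x₀ : 𝟙_ E ⟶ X) : E :=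
  equalizer (lift (toUnit ((ihom U).obj X) ≫ u₀) (𝟙 ((ihom U).obj X)) ≫ (ihom.ev U).app X)
    (toUnit ((ihom U).obj X) ≫ x₀)

section

variable {U X : E} {u₀ : 𝟙_ E ⟶ U} {x₀ : 𝟙_ E ⟶ X}

/-- The inclusion of the space of pointed maps into the exponential. -/
def Ptd.incl (u₀ : 𝟙_ E ⟶ U) (x₀ : 𝟙_ E ⟶ X) : Ptd u₀ x₀ ⟶ (ihom U).obj X := equalizer.ι _ _

/-- The map `U × T ⟶ X` named by an element at stage `T` of the space of pointed maps. -/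
def unc {T : E} (f : T ⟶ Ptd u₀ x₀) : U ⊗ T ⟶ X :=
  MonoidalClosed.uncurry (f ≫ Ptd.incl u₀ x₀)

lemma unc_comp {S T : E} (s : S ⟶ T) (f : T ⟶ Ptd u₀ x₀) : unc (s ≫ f) = U ◁ s ≫ unc f := by
  rw [unc, Category.assoc, MonoidalClosed.uncurry_natural_left]; rfl

/-- The map `T ⟶ U × T`, `t ↦ (u₀, t)`. -/
abbrev base (u₀ : 𝟙_ E ⟶ U) (T : E) : T ⟶ U ⊗ T := lift (toUnit T ≫ u₀) (𝟙 T)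

lemma base_uncurry (u₀ : 𝟙_ E ⟶ U) {T : E} (f : T ⟶ (ihom U).obj X) :
    base u₀ T ≫ MonoidalClosed.uncurry f =
      f ≫ lift (toUnit ((ihom U).obj X) ≫ u₀) (𝟙 ((ihom U).obj X)) ≫ (ihom.ev U).app X := by
  rw [MonoidalClosed.uncurry_eq, ← Category.assoc, ← Category.assoc]
  congr 1
  ext
  · simp
  · simp

lemma base_unc {T : E} (f : T ⟶ Ptd u₀ x₀) : base u₀ T ≫ unc f = toUnit T ≫ x₀ := by
  rw [unc, base_uncurry, Category.assoc]
  have h : f ≫ Ptd.incl u₀ x₀ ≫ _ = f ≫ Ptd.incl u₀ x₀ ≫ _ := f ≫= equalizer.condition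
    (lift (toUnit ((ihom U).obj X) ≫ u₀) (𝟙 ((ihom U).obj X)) ≫ (ihom.ev U).app X)
    (toUnit ((ihom U).obj X) ≫ x₀)
  refine h.trans ?_
  simp only [← Category.assoc]
  congr 1
  exact toUnit_unique _ _

/-- The element of the space of pointed maps named by a map `U × T ⟶ X`. -/
def name {T : E} (g : U ⊗ T ⟶ X) (h : base u₀ T ≫ g = toUnit T ≫ x₀) : T ⟶ Ptd u₀ x₀ :=
  equalizer.lift (MonoidalClosed.curry g) (by
    rw [← base_uncurry, MonoidalClosed.uncurry_curry, h, ← Category.assoc]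
    congr 1
    exact toUnit_unique _ _)

@[simp] lemma unc_name {T : E} (g : U ⊗ T ⟶ X) (h : base u₀ T ≫ g = toUnit T ≫ x₀) :
    unc (name g h) = g := by
  have h : name g h ≫ Ptd.incl u₀ x₀ = MonoidalClosed.curry g := equalizer.lift_ι _ _
  rw [unc, h, MonoidalClosed.uncurry_curry]

lemma unc_inj {T : E} {f g : T ⟶ Ptd u₀ x₀} (h : unc f = unc g) : f = g :=
  equalizer.hom_ext (MonoidalClosed.uncurry_injective h)

/-- The value at `d` of an element of the space of pointed maps. -/
def ap {S : E} (f : S ⟶ Ptd u₀ x₀) (d : S ⟶ U) : S ⟶ X := lift d (𝟙 S) ≫ unc f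

lemma comp_ap {S T : E} (s : S ⟶ T) (f : T ⟶ Ptd u₀ x₀) (d : T ⟶ U) :
    s ≫ ap f d = ap (s ≫ f) (s ≫ d) := by
  rw [ap, ap, unc_comp]
  simp only [← Category.assoc]
  congr 1
  ext <;> simp

lemma ap_comp {S T : E} (s : S ⟶ T) (f : T ⟶ Ptd u₀ x₀) (d : S ⟶ U) :
    ap (s ≫ f) d = lift d s ≫ unc f := by
  rw [ap, unc_comp]
  simp only [← Category.assoc]
  congr 1
  ext <;> simp

@[simp] lemma ap_name {S T : E} (s : S ⟶ T) (g : U ⊗ T ⟶ X)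
    (h : base u₀ T ≫ g = toUnit T ≫ x₀) (d : S ⟶ U) :
    ap (s ≫ name g h) d = lift d s ≫ g := by rw [ap_comp, unc_name]

lemma ptd_ext {T : E} {f g : T ⟶ Ptd u₀ x₀}
    (h : ∀ (S : E) (s : S ⟶ T) (d : S ⟶ U), ap (s ≫ f) d = ap (s ≫ g) d) : f = g := by
  apply unc_inj
  have := h (U ⊗ T) (snd U T) (fst U T)
  rw [ap_comp, ap_comp] at this
  simpa using this

lemma ap_zero {T : E} (f : T ⟶ Ptd u₀ x₀) (d : T ⟶ U) (h : d = toUnit T ≫ u₀) :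
    ap f d = toUnit T ≫ x₀ := by
  subst h; exact base_unc f

end

/-! ### First order infinitesimal objects -/

section

variable (k : Type w) [CommRing k] {R : E} [CommRingObj R] [AlgObj k R]

lemma infinitesimal_unit : IsInfinitesimal k R (𝟙_ E) := by
  refine ⟨k, inferInstance, inferInstance, ⟨inferInstance, inferInstance, AlgHom.id k k, 1, ?_⟩,
    ⟨Algebra.ofId _ _, fun T => ⟨fun f g _ => toUnit_unique f g, fun f => ⟨toUnit T, ?_⟩⟩⟩⟩
  · rw [pow_one, Ideal.zero_eq_bot, ← RingHom.injective_iff_ker_eq_bot]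
    exact Function.injective_id
  · exact Subsingleton.elim _ _

lemma IsWeil.tensor {W W' : Type w} [CommRing W] [Algebra k W] [CommRing W'] [Algebra k W']
    (h : IsWeil k W) (h' : IsWeil k W') : IsWeil k (W ⊗[k] W') := by
  obtain ⟨hf, hF, π, hπ⟩ := h
  obtain ⟨hf', hF', π', hπ'⟩ := h'
  refine ⟨inferInstance, inferInstance, Algebra.TensorProduct.productMap π π', ?_⟩
  set P := Algebra.TensorProduct.productMap π π' with hP
  have nil : ∀ x : W ⊗[k] W', IsNilpotent (x - algebraMap k _ (P x)) := by
    intro x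
    rw [← mem_nilradical]
    induction x with
    | zero => simp
    | add x y hx hy =>
      rw [map_add, map_add, add_sub_add_comm]
      exact add_mem hx hy
    | tmul a b =>
      have ha : IsNilpotent (a - algebraMap k W (π a)) := by
        obtain ⟨m, hm⟩ := hπ
        refine ⟨m, ?_⟩
        have := Ideal.pow_mem_pow (I := RingHom.ker π) (x := a - algebraMap k W (π a))
          (by simp [RingHom.mem_ker]) m
        rwa [hm] at this
      have hb : IsNilpotent (b - algebraMap k W' (π' b)) := by
        obtain ⟨m, hm⟩ := hπ'
        refine ⟨m, ?_⟩
        have := Ideal.pow_mem_pow (I := RingHom.ker π') (x := b - algebraMap k W' (π' b))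
          (by simp [RingHom.mem_ker]) m
        rwa [hm] at this
      have e : a ⊗ₜ[k] b - algebraMap k _ (P (a ⊗ₜ b)) =
          (a - algebraMap k W (π a)) ⊗ₜ 1 * (1 ⊗ₜ b) +
          algebraMap k (W ⊗[k] W') (π a) * (1 ⊗ₜ (b - algebraMap k W' (π' b))) := by
        simp only [hP, Algebra.TensorProduct.productMap_apply_tmul, map_mul,
          Algebra.TensorProduct.tmul_mul_tmul, TensorProduct.sub_tmul, TensorProduct.tmul_sub,
          Algebra.TensorProduct.algebraMap_apply, mul_sub, sub_mul, one_mul, mul_one]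
        have : (1 : W) ⊗ₜ[k] algebraMap k W' (π' b) = algebraMap k W (π' b) ⊗ₜ[k] (1 : W') := by
          rw [Algebra.algebraMap_eq_smul_one, Algebra.algebraMap_eq_smul_one,
            TensorProduct.smul_tmul]
        rw [show algebraMap k W (π a) ⊗ₜ[k] algebraMap k W' (π' b) =
          (algebraMap k W (π a) ⊗ₜ[k] (1 : W')) * ((1 : W) ⊗ₜ[k] algebraMap k W' (π' b)) by simp,
          this]
        simp
      rw [e]
      refine add_mem (Ideal.mul_mem_right _ _ ?_) (Ideal.mul_mem_left _ _ ?_)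
      · exact mem_nilradical.2 (ha.map (Algebra.TensorProduct.includeLeft : W →ₐ[k] W ⊗[k] W'))
      · exact mem_nilradical.2 (hb.map (Algebra.TensorProduct.includeRight : W' →ₐ[k] W ⊗[k] W'))
  have hFG : (RingHom.ker P).FG := by
    let L : W ⊗[k] W' →ₗ[k] W ⊗[k] W' :=
      LinearMap.id - (Algebra.linearMap k _).comp P.toLinearMap
    obtain ⟨S, hS⟩ := (inferInstance : Module.Finite k (W ⊗[k] W')).1
    classical
    refine ⟨S.image L, le_antisymm ?_ ?_⟩
    · rw [Ideal.span_le]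
      intro y hy
      obtain ⟨x, -, rfl⟩ := Finset.mem_image.1 (Finset.mem_coe.1 hy)
      change P (x - algebraMap k _ (P x)) = 0
      rw [map_sub, AlgHom.commutes, Algebra.algebraMap_self, RingHom.id_apply, sub_self]
    · intro x hx
      have hL : L x = x := by
        have : P x = 0 := hx
        simp [L, this]
      rw [← hL]
      have : L x ∈ Submodule.map L ⊤ := ⟨x, trivial, rfl⟩
      rw [← hS, Submodule.map_span] at this
      rw [Finset.coe_image]
      exact Submodule.span_le_restrictScalars k (W ⊗[k] W') _ this
  rw [hFG.isNilpotent_iff_le_nilradical]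
  intro x hx
  have h0 : P x = 0 := hx
  have := nil x
  rw [h0, map_zero, sub_zero] at this
  exact this

/-- The spectrum of a tensor product is the product of the spectra. -/
def Spec.tensor {W W' : Type w} [CommRing W] [Algebra k W] [CommRing W'] [Algebra k W']
    {X X' : E} (s : Spec k R W X) (s' : Spec k R W' X') : Spec k R (W ⊗[k] W') (X ⊗ X') where
  gen := Algebra.TensorProduct.productMap ((pullAlg k R (fst X X')).comp s.gen)
    ((pullAlg k R (snd X X')).comp s'.gen)
  bij T := by
    constructor
    · intro f g h
      ext
      · apply (s.bij T).1
        ext w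
        have := DFunLike.congr_fun h (w ⊗ₜ 1)
        simpa [pullAlg, pull] using this
      · apply (s'.bij T).1
        ext w
        have := DFunLike.congr_fun h (1 ⊗ₜ w)
        simpa [pullAlg, pull] using this
    · intro φ
      obtain ⟨f, hf⟩ := (s.bij T).2 (φ.comp Algebra.TensorProduct.includeLeft)
      obtain ⟨g, hg⟩ := (s'.bij T).2 (φ.comp Algebra.TensorProduct.includeRight)
      refine ⟨lift f g, ?_⟩
      apply Algebra.TensorProduct.ext
      · ext w
        have := DFunLike.congr_fun hf w
        simpa [pullAlg, pull] using this
      · ext w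
        have := DFunLike.congr_fun hg w
        simpa [pullAlg, pull] using this

lemma infinitesimal_tensor {X Y : E} (hX : IsInfinitesimal k R X) (hY : IsInfinitesimal k R Y) :
    IsInfinitesimal k R (X ⊗ Y) := by
  obtain ⟨W, _, _, hW, ⟨s⟩⟩ := hX
  obtain ⟨W', _, _, hW', ⟨s'⟩⟩ := hY
  exact ⟨W ⊗[k] W', inferInstance, inferInstance, hW.tensor k hW', ⟨s.tensor k s'⟩⟩

/-- An object `X` with `m` coordinates that represents the `m`-tuples of elements of `R` with
vanishing pairwise products. -/
structure FirstOrder (R : E) [CommRingObj R] (m : ℕ) (X : E) where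
  co : Fin m → (X ⟶ R)
  co_mul : ∀ i j, co i * co j = 0
  hom_ext : ∀ {T : E} {f g : T ⟶ X}, (∀ i, f ≫ co i = g ≫ co i) → f = g
  hom_ex : ∀ {T : E} (r : Fin m → (T ⟶ R)), (∀ i j, r i * r j = 0) → ∃ f : T ⟶ X, ∀ i, f ≫ co i = r i

lemma isWeil_tsze (m : ℕ) : IsWeil k (TrivSqZeroExt k (Fin m → k)) := by
  refine ⟨inferInstanceAs (Module.Finite k (k × (Fin m → k))),
    inferInstanceAs (Module.Free k (k × (Fin m → k))), TrivSqZeroExt.fstHom k k _, 2, ?_⟩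
  exact TrivSqZeroExt.kerIdeal_sq k (Fin m → k)

variable {k} in
/-- The linear map with prescribed values on the standard basis. -/
def linOf {m : ℕ} {T : E} (r : Fin m → (T ⟶ R)) : (Fin m → k) →ₗ[k] (T ⟶ R) :=
  (Pi.basisFun k (Fin m)).constr k r

lemma linOf_single {m : ℕ} {T : E} (r : Fin m → (T ⟶ R)) (i : Fin m) :
    linOf (k := k) r (Pi.single i 1) = r i := by
  have := (Pi.basisFun k (Fin m)).constr_basis k r i
  rwa [Pi.basisFun_apply] at this

lemma linOf_mul {m : ℕ} {T : E} (r : Fin m → (T ⟶ R)) (h : ∀ i j, r i * r j = 0)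
    (x y : Fin m → k) : linOf (k := k) r x * linOf (k := k) r y = 0 := by
  simp only [linOf, Module.Basis.constr_apply_fintype, Finset.sum_mul_sum]
  refine Finset.sum_eq_zero fun i _ => Finset.sum_eq_zero fun j _ => ?_
  rw [smul_mul_smul_comm, h, smul_zero]

/-- A first order object as a spectrum. -/
def FirstOrder.spec {m : ℕ} {X : E} (F : FirstOrder R m X) :
    Spec k R (TrivSqZeroExt k (Fin m → k)) X where
  gen := TrivSqZeroExt.liftEquivOfComm ⟨linOf F.co, linOf_mul k F.co F.co_mul⟩
  bij T := by
    constructor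
    · intro f g h
      refine F.hom_ext fun i => ?_
      have := DFunLike.congr_fun h (TrivSqZeroExt.inr (Pi.single i 1))
      simpa [pullAlg, pull, linOf_single] using this
    · intro φ
      obtain ⟨f, hf⟩ := F.hom_ex (fun i => φ (TrivSqZeroExt.inr (Pi.single i 1))) (fun i j => by
        rw [← map_mul, TrivSqZeroExt.inr_mul_inr, map_zero])
      refine ⟨f, ?_⟩
      apply TrivSqZeroExt.algHom_ext'
      · ext
      · refine (Pi.basisFun k (Fin m)).ext fun i => ?_
        simpa [pullAlg, pull, linOf_single] using hf i

lemma FirstOrder.infinitesimal {m : ℕ} {X : E} (F : FirstOrder R m X) : IsInfinitesimal k R X :=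
  ⟨_, inferInstance, inferInstance, isWeil_tsze k m, ⟨F.spec k⟩⟩

lemma FirstOrder.bijective [KockLawvere k R] {m : ℕ} {X : E} (F : FirstOrder R m X) (T : E) :
    Function.Bijective fun p : (T ⟶ R) × (Fin m → (T ⟶ R)) =>
      snd X T ≫ p.1 + ∑ i, (fst X T ≫ F.co i) * (snd X T ≫ p.2 i) := by
  have hb := KockLawvere.bijective (TrivSqZeroExt k (Fin m → k)) (isWeil_tsze k m) X (F.spec k) T
  let e : Fin m → TrivSqZeroExt k (Fin m → k) := fun i => TrivSqZeroExt.inr (Pi.single i 1)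
  let Θ : (T ⟶ R) × (Fin m → (T ⟶ R)) → TrivSqZeroExt k (Fin m → k) ⊗[k] (T ⟶ R) :=
    fun p => 1 ⊗ₜ p.1 + ∑ i, e i ⊗ₜ p.2 i
  have hcomp : (fun p : (T ⟶ R) × (Fin m → (T ⟶ R)) =>
      snd X T ≫ p.1 + ∑ i, (fst X T ≫ F.co i) * (snd X T ≫ p.2 i)) =
      comparison k R (F.spec k) T ∘ Θ := by
    funext p
    simp [Θ, e, comparison, FirstOrder.spec, linOf_single, pullAlg, pull]
  rw [hcomp]
  refine hb.comp ⟨?_, ?_⟩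
  · let A : TrivSqZeroExt k (Fin m → k) ⊗[k] (T ⟶ R) →ₗ[k] (T ⟶ R) :=
      TensorProduct.lift ((LinearMap.lsmul k (T ⟶ R)).comp
        (TrivSqZeroExt.fstHom k k (Fin m → k)).toLinearMap)
    let B : Fin m → TrivSqZeroExt k (Fin m → k) ⊗[k] (T ⟶ R) →ₗ[k] (T ⟶ R) := fun i =>
      TensorProduct.lift ((LinearMap.lsmul k (T ⟶ R)).comp
        ((LinearMap.proj i).comp (TrivSqZeroExt.sndHom k (Fin m → k))))
    have hA : ∀ p, A (Θ p) = p.1 := fun p => by simp [A, Θ, e]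
    have hB : ∀ p i, B i (Θ p) = p.2 i := fun p i => by
      simp [B, Θ, e, Pi.single_apply]
    intro p q h
    refine Prod.ext ?_ (funext fun i => ?_)
    · rw [← hA p, ← hA q, h]
    · rw [← hB p, ← hB q, h]
  · intro x
    induction x with
    | zero => exact ⟨0, by simp [Θ]⟩
    | add x y hx hy =>
      obtain ⟨p, rfl⟩ := hx
      obtain ⟨q, rfl⟩ := hy
      refine ⟨p + q, ?_⟩
      simp only [Θ, Prod.fst_add, Prod.snd_add, Pi.add_apply, TensorProduct.tmul_add,
        Finset.sum_add_distrib]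
      abel
    | tmul w a =>
      refine ⟨(w.fst • a, fun i => w.snd i • a), ?_⟩
      have hw : w = w.fst • (1 : TrivSqZeroExt k (Fin m → k)) + ∑ i, w.snd i • e i := by
        have hs : ∑ i, w.snd i • e i = TrivSqZeroExt.inr w.snd := by
          have h1 : ∀ i, e i = TrivSqZeroExt.inrHom k (Fin m → k) (Pi.single i 1) := fun _ => rfl
          simp only [h1, ← map_smul, ← map_sum]
          change TrivSqZeroExt.inr _ = _
          congr 1
          exact (pi_eq_sum_univ' w.snd).symm
        rw [hs]
        conv_lhs => rw [← TrivSqZeroExt.inl_fst_add_inr_snd_eq w]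
        congr 1
        apply TrivSqZeroExt.ext <;> simp
      simp only [Θ]
      conv_rhs => rw [hw]
      simp only [TensorProduct.add_tmul, TensorProduct.sum_tmul, TensorProduct.smul_tmul]

end

lemma pt_ext {X T M : E} {f g : X ⊗ T ⟶ M}
    (h : ∀ (S : E) (x : S ⟶ X) (t : S ⟶ T), lift x t ≫ f = lift x t ≫ g) : f = g := by
  simpa using h _ (fst X T) (snd X T)

section

variable {R : E} [CommRingObj R]

lemma incl_sq {T : E} (d : T ⟶ D R 1) : (d ≫ incl R 1) * (d ≫ incl R 1) = 0 := by
  rw [← sq]; exact incl_pow d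

/-- `D` as a first order object. -/
def firstOrderD (R : E) [CommRingObj R] : FirstOrder R 1 (D R 1) where
  co _ := incl R 1
  co_mul _ _ := by simpa using incl_sq (𝟙 (D R 1))
  hom_ext h := D_ext (h 0)
  hom_ex r h := ⟨toD (r 0) (by rw [sq]; exact h 0 0), fun i => by
    rw [toD_incl, Subsingleton.elim i 0]⟩

/-- `D(2) = {(d, d') ∈ D × D | d d' = 0}`. -/
def DD (R : E) [CommRingObj R] : E :=
  equalizer ((fst (D R 1) (D R 1) ≫ incl R 1) * (snd (D R 1) (D R 1) ≫ incl R 1)) 0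

/-- The inclusion of `D(2)` in `D × D`. -/
def DDincl (R : E) [CommRingObj R] : DD R ⟶ D R 1 ⊗ D R 1 := equalizer.ι _ _

/-- The element of `D(2)` given by two elements of `D` with product zero. -/
def toDD {T : E} (d d' : T ⟶ D R 1) (h : (d ≫ incl R 1) * (d' ≫ incl R 1) = 0) : T ⟶ DD R :=
  equalizer.lift (lift d d') (by rw [comp_mul', comp_zero']; simpa using h)

@[simp] lemma toDD_incl {T : E} (d d' : T ⟶ D R 1) (h : (d ≫ incl R 1) * (d' ≫ incl R 1) = 0) :
    toDD d d' h ≫ DDincl R = lift d d' := equalizer.lift_ι _ _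

lemma DD_ext {T : E} {p q : T ⟶ DD R} (h : p ≫ DDincl R = q ≫ DDincl R) : p = q :=
  equalizer.hom_ext h

lemma DD_mul {T : E} (p : T ⟶ DD R) :
    ((p ≫ DDincl R ≫ fst _ _) ≫ incl R 1) * ((p ≫ DDincl R ≫ snd _ _) ≫ incl R 1) = 0 := by
  have h : p ≫ DDincl R ≫ _ = p ≫ DDincl R ≫ _ := p ≫= equalizer.condition
    ((fst (D R 1) (D R 1) ≫ incl R 1) * (snd (D R 1) (D R 1) ≫ incl R 1)) 0
  rw [comp_mul', comp_zero', comp_mul', comp_zero'] at h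
  simpa using h

/-- `D(2)` as a first order object. -/
def firstOrderDD (R : E) [CommRingObj R] : FirstOrder R 2 (DD R) where
  co := ![DDincl R ≫ fst _ _ ≫ incl R 1, DDincl R ≫ snd _ _ ≫ incl R 1]
  co_mul i j := by
    have h01 := DD_mul (𝟙 (DD R))
    have h0 := incl_sq (DDincl R ≫ fst _ _)
    have h1 := incl_sq (DDincl R ≫ snd _ _)
    simp only [Category.id_comp, Category.assoc] at h01 h0 h1
    have h10 := h01
    rw [mul_comm] at h10
    fin_cases i <;> fin_cases j <;> simpa
  hom_ext h := by
    have h0 := h 0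
    have h1 := h 1
    apply DD_ext
    ext <;> apply D_ext
    · simpa using h0
    · simpa using h1
  hom_ex r h := ⟨toDD (toD (r 0) (by rw [sq]; exact h 0 0)) (toD (r 1) (by rw [sq]; exact h 1 1))
      (by simpa using h 0 1), fun i => by
    fin_cases i
    · simp only [Fin.zero_eta, Matrix.cons_val_zero, ← Category.assoc, toDD_incl, lift_fst,
        toD_incl]
    · simp only [Fin.mk_one, Matrix.cons_val_one, Matrix.cons_val_zero, ← Category.assoc, toDD_incl,
        lift_snd, toD_incl]⟩

/-- Multiplication of elements of `D`. -/
def mulD {T : E} (d d' : T ⟶ D R 1) : T ⟶ D R 1 :=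
  toD ((d ≫ incl R 1) * (d' ≫ incl R 1)) (by
    rw [mul_pow, incl_pow, zero_mul])

/-- Multiplication of an element of `D` by an element of `R`. -/
def scaleD {T : E} (r : T ⟶ R) (d : T ⟶ D R 1) : T ⟶ D R 1 :=
  toD (r * (d ≫ incl R 1)) (by rw [mul_pow, incl_pow, mul_zero])

/-- The element `0` of `D` at stage `T`. -/
abbrev zD (R : E) [CommRingObj R] (T : E) : T ⟶ D R 1 := toUnit T ≫ zeroD R 1

lemma zeroD_incl' {T : E} (n : ℕ) : (toUnit T ≫ zeroD R n) ≫ incl R n = 0 := by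
  rw [Category.assoc, zeroD, toD_incl, comp_zero']

lemma zD_incl {T : E} : zD R T ≫ incl R 1 = 0 := zeroD_incl' 1

lemma eq_zD {T : E} {d : T ⟶ D R 1} (h : d ≫ incl R 1 = 0) : d = zD R T :=
  D_ext (h.trans zD_incl.symm)

lemma mulD_incl {T : E} (d d' : T ⟶ D R 1) :
    mulD d d' ≫ incl R 1 = (d ≫ incl R 1) * (d' ≫ incl R 1) := toD_incl _ _

lemma scaleD_incl {T : E} (r : T ⟶ R) (d : T ⟶ D R 1) :
    scaleD r d ≫ incl R 1 = r * (d ≫ incl R 1) := toD_incl _ _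

lemma comp_mulD {S T : E} (s : S ⟶ T) (d d' : T ⟶ D R 1) :
    s ≫ mulD d d' = mulD (s ≫ d) (s ≫ d') := by
  apply D_ext
  rw [Category.assoc, mulD_incl, mulD_incl, comp_mul', Category.assoc, Category.assoc]

lemma comp_scaleD {S T : E} (s : S ⟶ T) (r : T ⟶ R) (d : T ⟶ D R 1) :
    s ≫ scaleD r d = scaleD (s ≫ r) (s ≫ d) := by
  apply D_ext
  rw [Category.assoc, scaleD_incl, scaleD_incl, comp_mul', Category.assoc]

lemma comp_zD {S T : E} (s : S ⟶ T) : s ≫ zD R T = zD R S := by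
  rw [← Category.assoc, toUnit_unique (s ≫ toUnit T) (toUnit S)]

lemma comp_toDD {S T : E} (s : S ⟶ T) (d d' : T ⟶ D R 1)
    (h : (d ≫ incl R 1) * (d' ≫ incl R 1) = 0) (h') :
    s ≫ toDD d d' h = toDD (s ≫ d) (s ≫ d') h' := by
  apply DD_ext
  rw [Category.assoc, toDD_incl, toDD_incl, comp_lift]

lemma perceives_span {A B C P M : E} {f : A ⟶ B} {g : A ⟶ C} {i : B ⟶ P} {j : C ⟶ P}
    (w : f ≫ i = g ≫ j) :
    Perceives M (PushoutCocone.mk i j w) ↔ ∀ (T : E) (a : B ⊗ T ⟶ M) (b : C ⊗ T ⟶ M),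
      f ▷ T ≫ a = g ▷ T ≫ b → ∃! h : P ⊗ T ⟶ M, i ▷ T ≫ h = a ∧ j ▷ T ≫ h = b := by
  constructor
  · intro H T a b hab
    obtain ⟨h, hh, hu⟩ := H T (fun x => match x with
      | .zero => f ▷ T ≫ a
      | .left => a
      | .right => b) (by
        rintro (_ | _ | _) (_ | _ | _) (_ | _) <;> simp [hab])
    refine ⟨h, ⟨hh .left, hh .right⟩, fun h' ⟨h1, h2⟩ => hu h' ?_⟩
    rintro (_ | _ | _)
    · change (f ≫ i) ▷ T ≫ h' = f ▷ T ≫ a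
      rw [comp_whiskerRight, Category.assoc, h1]
    · exact h1
    · exact h2
  · intro H T a ha
    have h1 := ha WalkingSpan.Hom.fst
    have h2 := ha WalkingSpan.Hom.snd
    obtain ⟨h, ⟨hl, hr⟩, hu⟩ := H T (a .left) (a .right) (h1.trans h2.symm)
    refine ⟨h, ?_, fun h' hh => hu h' ⟨hh .left, hh .right⟩⟩
    rintro (_ | _ | _)
    · have : f ▷ T ≫ a .left = a .zero := h1
      change (f ≫ i) ▷ T ≫ h = a .zero
      rw [← this, ← hl, comp_whiskerRight, Category.assoc]
    · exact hl
    · exact hr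

lemma kl_D (k : Type w) [CommRing k] [AlgObj k R] [KockLawvere k R] (T : E) : Function.Bijective fun p : (T ⟶ R) × (T ⟶ R) =>
    snd (D R 1) T ≫ p.1 + (fst (D R 1) T ≫ incl R 1) * (snd (D R 1) T ≫ p.2) := by
  have h := FirstOrder.bijective k (firstOrderD R) T
  have e : Function.Bijective fun p : (T ⟶ R) × (T ⟶ R) =>
      ((p.1, fun _ => p.2) : (T ⟶ R) × (Fin 1 → (T ⟶ R))) :=
    ⟨fun p q h => Prod.ext (Prod.ext_iff.1 h).1 (congrFun (Prod.ext_iff.1 h).2 0),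
      fun p => ⟨(p.1, p.2 0), Prod.ext rfl (funext fun i => by rw [Subsingleton.elim i 0])⟩⟩
  convert! h.comp e using 1
  funext p
  simp [firstOrderD]

lemma kl_DD (k : Type w) [CommRing k] [AlgObj k R] [KockLawvere k R] (T : E) : Function.Bijective fun p : (T ⟶ R) × (T ⟶ R) × (T ⟶ R) =>
    snd (DD R) T ≫ p.1 + ((fst (DD R) T ≫ DDincl R ≫ fst _ _ ≫ incl R 1) * (snd (DD R) T ≫ p.2.1) +
      (fst (DD R) T ≫ DDincl R ≫ snd _ _ ≫ incl R 1) * (snd (DD R) T ≫ p.2.2)) := by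
  have h := FirstOrder.bijective k (firstOrderDD R) T
  have e : Function.Bijective fun p : (T ⟶ R) × (T ⟶ R) × (T ⟶ R) =>
      ((p.1, ![p.2.1, p.2.2]) : (T ⟶ R) × (Fin 2 → (T ⟶ R))) :=
    ⟨fun p q h => Prod.ext (Prod.ext_iff.1 h).1 (Prod.ext (congrFun (Prod.ext_iff.1 h).2 0)
      (congrFun (Prod.ext_iff.1 h).2 1)),
      fun p => ⟨(p.1, p.2 0, p.2 1), Prod.ext rfl (funext fun i => by fin_cases i <;> rfl)⟩⟩
  convert! h.comp e using 1
  funext p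
  simp [firstOrderDD, Fin.sum_univ_two]

lemma lift_whisker {X Y T M S : E} (f : X ⟶ Y) (g : Y ⊗ T ⟶ M) (x : S ⟶ X) (t : S ⟶ T) :
    lift x t ≫ f ▷ T ≫ g = lift (x ≫ f) t ≫ g := by simp

/-- The two axes of `D(2)`. -/
def axis1 (R : E) [CommRingObj R] : D R 1 ⟶ DD R :=
  toDD (𝟙 _) (zD R _) (by rw [zD_incl, mul_zero])

/-- The two axes of `D(2)`. -/
def axis2 (R : E) [CommRingObj R] : D R 1 ⟶ DD R :=
  toDD (zD R _) (𝟙 _) (by rw [zD_incl, zero_mul])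

lemma comp_axis1 {T : E} (d : T ⟶ D R 1) :
    d ≫ axis1 R = toDD d (zD R T) (by rw [zD_incl, mul_zero]) := by
  apply DD_ext
  rw [Category.assoc, axis1, toDD_incl, toDD_incl, comp_lift, comp_zD, Category.comp_id]

lemma comp_axis2 {T : E} (d : T ⟶ D R 1) :
    d ≫ axis2 R = toDD (zD R T) d (by rw [zD_incl, zero_mul]) := by
  apply DD_ext
  rw [Category.assoc, axis2, toDD_incl, toDD_incl, comp_lift, comp_zD, Category.comp_id]

lemma axes_zero : zeroD R 1 ≫ axis1 R = zeroD R 1 ≫ axis2 R := by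
  rw [comp_axis1, comp_axis2]
  apply DD_ext
  rw [toDD_incl, toDD_incl]
  have : zeroD R 1 = zD R (𝟙_ E) := by
    rw [zD, toUnit_unique (toUnit (𝟙_ E)) (𝟙 _), Category.id_comp]
  rw [← this]

/-- Multiplication `D × D ⟶ D`. -/
def mulDmap (R : E) [CommRingObj R] : D R 1 ⊗ D R 1 ⟶ D R 1 := mulD (fst _ _) (snd _ _)

lemma lift_mulDmap {T : E} (d d' : T ⟶ D R 1) : lift d d' ≫ mulDmap R = mulD d d' := by
  rw [mulDmap, comp_mulD, lift_fst, lift_snd]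

lemma DD_mulDmap : DDincl R ≫ mulDmap R = toUnit _ ≫ zeroD R 1 := by
  apply D_ext
  rw [zeroD_incl', mulDmap, comp_mulD, mulD_incl]
  simpa using DD_mul (𝟙 (DD R))

lemma comp_kl_D {S T : E} (p : (T ⟶ R) × (T ⟶ R)) (d : S ⟶ D R 1) (t : S ⟶ T) :
    lift d t ≫ (snd (D R 1) T ≫ p.1 + (fst (D R 1) T ≫ incl R 1) * (snd (D R 1) T ≫ p.2)) =
      t ≫ p.1 + (d ≫ incl R 1) * (t ≫ p.2) := by
  simp [comp_add', comp_mul']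

lemma comp_kl_DD {S T : E} (p : (T ⟶ R) × (T ⟶ R) × (T ⟶ R)) (d d' : S ⟶ D R 1) (h) (t : S ⟶ T) :
    lift (toDD d d' h) t ≫ (snd (DD R) T ≫ p.1 +
      ((fst (DD R) T ≫ DDincl R ≫ fst _ _ ≫ incl R 1) * (snd (DD R) T ≫ p.2.1) +
      (fst (DD R) T ≫ DDincl R ≫ snd _ _ ≫ incl R 1) * (snd (DD R) T ≫ p.2.2))) =
      t ≫ p.1 + ((d ≫ incl R 1) * (t ≫ p.2.1) + (d' ≫ incl R 1) * (t ≫ p.2.2)) := by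
  have h1 : toDD d d' h ≫ DDincl R ≫ fst _ _ ≫ incl R 1 = d ≫ incl R 1 := by
    rw [← Category.assoc, toDD_incl, lift_fst_assoc]
  have h2 : toDD d d' h ≫ DDincl R ≫ snd _ _ ≫ incl R 1 = d' ≫ incl R 1 := by
    rw [← Category.assoc, toDD_incl, lift_snd_assoc]
  simp [comp_add', comp_mul', h1, h2]

lemma DD_pt_ext {T M : E} {f g : DD R ⊗ T ⟶ M}
    (h : ∀ (S : E) (d d' : S ⟶ D R 1) (hd) (t : S ⟶ T),
      lift (toDD d d' hd) t ≫ f = lift (toDD d d' hd) t ≫ g) : f = g := by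
  apply pt_ext
  intro S x t
  have hx : x = toDD (x ≫ DDincl R ≫ fst _ _) (x ≫ DDincl R ≫ snd _ _) (DD_mul x) := by
    apply DD_ext
    rw [toDD_incl]
    ext <;> simp
  rw [hx]
  exact h S _ _ _ t

lemma perceives_DD (k : Type w) [CommRing k] [AlgObj k R] [KockLawvere k R] :
    Perceives R (PushoutCocone.mk (axis1 R) (axis2 R) axes_zero) := by
  rw [perceives_span]
  intro T a b hab
  obtain ⟨p, rfl⟩ := (kl_D k T).2 a
  obtain ⟨q, rfl⟩ := (kl_D k T).2 b
  dsimp only at hab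
  have h0 : p.1 = q.1 := by
    have := congrArg (fun f => lift (toUnit T) (𝟙 T) ≫ f) hab
    simp only [lift_whisker, comp_kl_D, zeroD_incl', zero_mul, add_zero, Category.id_comp] at this
    exact this
  refine ⟨snd (DD R) T ≫ p.1 + ((fst (DD R) T ≫ DDincl R ≫ fst _ _ ≫ incl R 1) *
    (snd (DD R) T ≫ p.2) + (fst (DD R) T ≫ DDincl R ≫ snd _ _ ≫ incl R 1) * (snd (DD R) T ≫ q.2)),
    ⟨?_, ?_⟩, ?_⟩
  · apply pt_ext
    intro S d t
    rw [lift_whisker, comp_axis1, comp_kl_DD (p.1, p.2, q.2), comp_kl_D, zD_incl]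
    simp
  · apply pt_ext
    intro S d t
    rw [lift_whisker, comp_axis2, comp_kl_DD (p.1, p.2, q.2), comp_kl_D, zD_incl]
    simp [h0]
  · rintro h ⟨h1, h2⟩
    obtain ⟨r, rfl⟩ := (kl_DD k T).2 h
    dsimp only at h1 h2
    have e1 : (r.1, r.2.1) = p := by
      apply (kl_D k T).1
      refine Eq.trans ?_ h1
      apply pt_ext
      intro S d t
      rw [lift_whisker, comp_axis1, comp_kl_DD, comp_kl_D, zD_incl]
      simp
    have e2 : (r.1, r.2.2) = q := by
      apply (kl_D k T).1
      refine Eq.trans ?_ h2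
      apply pt_ext
      intro S d t
      rw [lift_whisker, comp_axis2, comp_kl_DD, comp_kl_D, zD_incl]
      simp
    rw [← e1, ← e2]

lemma perceives_mul (k : Type w) [CommRing k] [AlgObj k R] [KockLawvere k R] :
    Perceives R (PushoutCocone.mk (mulDmap R) (zeroD R 1) DD_mulDmap) := by
  rw [perceives_span]
  intro T f g hfg
  obtain ⟨p, hp⟩ := (kl_D k (D R 1 ⊗ T)).2
    (lift (lift (fst _ _) (snd _ _ ≫ fst _ _)) (snd _ _ ≫ snd _ _) ≫ f)
  obtain ⟨a, ha⟩ := (kl_D k T).2 p.1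
  obtain ⟨b, hb⟩ := (kl_D k T).2 p.2
  have hf : ∀ (S : E) (d d' : S ⟶ D R 1) (t : S ⟶ T), lift (lift d d') t ≫ f =
      t ≫ a.1 + (d' ≫ incl R 1) * (t ≫ a.2) +
        (d ≫ incl R 1) * (t ≫ b.1 + (d' ≫ incl R 1) * (t ≫ b.2)) := by
    intro S d d' t
    have := congrArg (fun h => lift d (lift d' t) ≫ h) hp
    dsimp only at this
    rw [comp_kl_D, ← ha, ← hb] at this
    dsimp only at this
    rw [comp_kl_D, comp_kl_D] at this
    rw [this, ← Category.assoc]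
    congr 1
    ext <;> simp
  have h0 : (a.1, b.1, a.2) = (lift (toUnit T) (𝟙 T) ≫ g, 0, 0) := by
    apply (kl_DD k T).1
    dsimp only
    apply DD_pt_ext
    intro S d d' hd t
    rw [comp_kl_DD (a.1, b.1, a.2), comp_kl_DD (lift (toUnit T) (𝟙 T) ≫ g, 0, 0)]
    have := congrArg (fun h => lift (toDD d d' hd) t ≫ h) hfg
    rw [lift_whisker, lift_whisker, toDD_incl, hf] at this
    have e : t ≫ lift (toUnit T) (𝟙 T) ≫ g = lift (toDD d d' hd ≫ toUnit (DD R)) t ≫ g := by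
      rw [← Category.assoc]
      congr 1
      ext
      simp
    dsimp only
    rw [e, ← this, comp_zero', mul_zero, mul_zero, add_zero, add_zero, mul_add, ← mul_assoc, hd,
      zero_mul, add_zero]
    ring
  have h1 := (Prod.ext_iff.1 h0).1
  have h2 := (Prod.ext_iff.1 (Prod.ext_iff.1 h0).2).1
  have h3 := (Prod.ext_iff.1 (Prod.ext_iff.1 h0).2).2
  dsimp only at h1 h2 h3
  rw [h2, h3] at hf
  refine ⟨snd (D R 1) T ≫ a.1 + (fst (D R 1) T ≫ incl R 1) * (snd (D R 1) T ≫ b.2),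
    ⟨?_, ?_⟩, ?_⟩
  · apply pt_ext
    intro S x t
    obtain ⟨d, d', rfl⟩ : ∃ d d', x = lift d d' := ⟨x ≫ fst _ _, x ≫ snd _ _, by ext <;> simp⟩
    rw [lift_whisker, lift_mulDmap, comp_kl_D (a.1, b.2), hf, mulD_incl]
    simp only [comp_zero']
    ring
  · apply pt_ext
    intro S x t
    rw [toUnit_unique x (toUnit S), lift_whisker, comp_kl_D (a.1, b.2), zeroD_incl', zero_mul,
      add_zero, h1, ← Category.assoc]
    congr 1
    ext
    simp
  · rintro h ⟨e1, -⟩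
    obtain ⟨r, rfl⟩ := (kl_D k T).2 h
    dsimp only at e1
    have hr : ∀ (S : E) (d d' : S ⟶ D R 1) (t : S ⟶ T),
        t ≫ r.1 + (d ≫ incl R 1) * (d' ≫ incl R 1) * (t ≫ r.2) =
        t ≫ a.1 + (d ≫ incl R 1) * ((d' ≫ incl R 1) * (t ≫ b.2)) := by
      intro S d d' t
      have := congrArg (fun h => lift (lift d d') t ≫ h) e1
      rw [lift_whisker, lift_mulDmap, comp_kl_D, hf, mulD_incl, comp_zero', mul_zero,
        add_zero, zero_add] at this
      exact this
    have i1 : r.1 = a.1 := by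
      have := hr T (zD R T) (zD R T) (𝟙 T)
      rw [zD_incl] at this
      simpa using this
    have i2 : r.2 = b.2 := by
      have j : (snd (D R 1) T ≫ r.1, (fst (D R 1) T ≫ incl R 1) * (snd (D R 1) T ≫ r.2)) =
          (snd (D R 1) T ≫ a.1, (fst (D R 1) T ≫ incl R 1) * (snd (D R 1) T ≫ b.2)) := by
        apply (kl_D k (D R 1 ⊗ T)).1
        dsimp only
        apply pt_ext
        intro S d x
        rw [comp_kl_D (_, _), comp_kl_D (_, _)]
        have := hr S d (x ≫ fst _ _) (x ≫ snd _ _)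
        simpa [comp_mul', mul_assoc] using this
      have j2 := (Prod.ext_iff.1 j).2
      dsimp only at j2
      have := @(kl_D k T).1 (0, r.2) (0, b.2) (by simpa [comp_zero'] using j2)
      exact (Prod.ext_iff.1 this).2
    dsimp only
    rw [i1, i2]

lemma infinitesimal_D (k : Type w) [CommRing k] [AlgObj k R] : IsInfinitesimal k R (D R 1) :=
  (firstOrderD R).infinitesimal k

lemma infinitesimal_DD (k : Type w) [CommRing k] [AlgObj k R] : IsInfinitesimal k R (DD R) :=
  (firstOrderDD R).infinitesimal k

/-- A map on `D(2)` into a microlinear object is determined by its restrictions to the axes. -/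
lemma micro_DD {k : Type w} [CommRing k] [AlgObj k R] [KockLawvere k R] {M : E}
    (hM : Microlinear k R M) {T : E} {f g : DD R ⊗ T ⟶ M}
    (h1 : axis1 R ▷ T ≫ f = axis1 R ▷ T ≫ g) (h2 : axis2 R ▷ T ≫ f = axis2 R ▷ T ≫ g) : f = g := by
  have := hM _ _ (PushoutCocone.mk (axis1 R) (axis2 R) axes_zero) (by
    rintro (_ | _ | _)
    · exact infinitesimal_unit k
    · exact infinitesimal_D k
    · exact infinitesimal_D k) (infinitesimal_DD k) (perceives_DD k)
  rw [perceives_span] at this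
  refine (this T (axis1 R ▷ T ≫ f) (axis2 R ▷ T ≫ f) ?_).unique ⟨rfl, rfl⟩ ⟨h1.symm, h2.symm⟩
  rw [← comp_whiskerRight_assoc, ← comp_whiskerRight_assoc, axes_zero]

/-- A map on `D × D` into a microlinear object that is constant on the axes factors uniquely
through multiplication. -/
lemma micro_mul {k : Type w} [CommRing k] [AlgObj k R] [KockLawvere k R] {M : E}
    (hM : Microlinear k R M) {T : E} (f : (D R 1 ⊗ D R 1) ⊗ T ⟶ M) (g : T ⟶ M)
    (h1 : ∀ (S : E) (d : S ⟶ D R 1) (t : S ⟶ T), lift (lift d (zD R S)) t ≫ f = t ≫ g)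
    (h2 : ∀ (S : E) (d : S ⟶ D R 1) (t : S ⟶ T), lift (lift (zD R S) d) t ≫ f = t ≫ g) :
    ∃! h : D R 1 ⊗ T ⟶ M, ∀ (S : E) (d d' : S ⟶ D R 1) (t : S ⟶ T),
      lift (mulD d d') t ≫ h = lift (lift d d') t ≫ f := by
  have := hM _ _ (PushoutCocone.mk (mulDmap R) (zeroD R 1) DD_mulDmap) (by
    rintro (_ | _ | _)
    · exact infinitesimal_DD k
    · exact infinitesimal_tensor k (infinitesimal_D k) (infinitesimal_D k)
    · exact infinitesimal_unit k) (infinitesimal_D k) (perceives_mul k)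
  rw [perceives_span] at this
  obtain ⟨h, ⟨hh, hh'⟩, hu⟩ := this T f (snd _ _ ≫ g) (by
    apply micro_DD hM
    · apply pt_ext
      intro S d t
      rw [lift_whisker, lift_whisker, comp_axis1, toDD_incl, h1, lift_whisker, lift_whisker,
        lift_snd_assoc]
    · apply pt_ext
      intro S d t
      rw [lift_whisker, lift_whisker, comp_axis2, toDD_incl, h2, lift_whisker, lift_whisker,
        lift_snd_assoc])
  refine ⟨h, ?_, ?_⟩
  · intro S d d' t
    rw [← hh, lift_whisker, lift_mulDmap]
  · intro h' hyp
    have e : mulDmap R ▷ T ≫ h' = f := by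
      apply pt_ext
      intro S x t
      obtain ⟨d, d', rfl⟩ : ∃ d d', x = lift d d' := ⟨x ≫ fst _ _, x ≫ snd _ _, by ext <;> simp⟩
      rw [lift_whisker, lift_mulDmap, hyp]
    refine hu h' ⟨e, ?_⟩
    apply pt_ext
    intro S x t
    rw [toUnit_unique x (toUnit S), lift_whisker, lift_snd_assoc, ← h1 S (zD R S) t, ← hyp]
    congr 2
    apply D_ext
    rw [mulD_incl, zD_incl, mul_zero]

end

/-! ### Lie algebra objects -/

/-- Lie algebras: Euclidean `R`-modules with a bilinear, antisymmetric bracket satisfying the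
Jacobi identity, whose underlying object is microlinear. -/
structure LieAlg (k : Type w) [CommRing k] (R : E) [CommRingObj R] [AlgObj k R] where
  X : E
  [add : AddGrpObj X]
  [comm : IsCommAddMonObj X]
  [mod : ModObj R X]
  smul_add : ∀ {T : E} (r : T ⟶ R) (x y : T ⟶ X), r • (x + y) = r • x + r • y
  add_smul : ∀ {T : E} (r s : T ⟶ R) (x : T ⟶ X), (r + s) • x = r • x + s • x
  euclidean : ∀ {T : E} (f : D R 1 ⊗ T ⟶ X), ∃! p : (T ⟶ X) × (T ⟶ X),
    f = snd (D R 1) T ≫ p.1 + (fst (D R 1) T ≫ incl R 1) • (snd (D R 1) T ≫ p.2)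
  bracket : X ⊗ X ⟶ X
  add_bracket : ∀ {T : E} (x y z : T ⟶ X),
    lift (x + y) z ≫ bracket = lift x z ≫ bracket + lift y z ≫ bracket
  bracket_add : ∀ {T : E} (x y z : T ⟶ X),
    lift x (y + z) ≫ bracket = lift x y ≫ bracket + lift x z ≫ bracket
  smul_bracket : ∀ {T : E} (r : T ⟶ R) (x y : T ⟶ X),
    lift (r • x) y ≫ bracket = r • (lift x y ≫ bracket)
  bracket_smul : ∀ {T : E} (r : T ⟶ R) (x y : T ⟶ X),
    lift x (r • y) ≫ bracket = r • (lift x y ≫ bracket)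
  antisymm : ∀ {T : E} (x y : T ⟶ X), lift x y ≫ bracket = -(lift y x ≫ bracket)
  jacobi : ∀ {T : E} (x y z : T ⟶ X),
    lift x (lift y z ≫ bracket) ≫ bracket + lift y (lift z x ≫ bracket) ≫ bracket +
      lift z (lift x y ≫ bracket) ≫ bracket = 0
  microlinear : Microlinear k R X

attribute [instance] LieAlg.add LieAlg.comm LieAlg.mod

/-- Isomorphisms of Lie algebras: `R`-linear isomorphisms that preserve the bracket. -/
structure LieAlg.Iso {k : Type w} [CommRing k] {R : E} [CommRingObj R] [AlgObj k R]
    (L L' : LieAlg k R) where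
  iso : L.X ≅ L'.X
  map_add : ∀ {T : E} (x y : T ⟶ L.X), (x + y) ≫ iso.hom = x ≫ iso.hom + y ≫ iso.hom
  map_smul : ∀ {T : E} (r : T ⟶ R) (x : T ⟶ L.X), (r • x) ≫ iso.hom = r • (x ≫ iso.hom)
  map_bracket : ∀ {T : E} (x y : T ⟶ L.X),
    (lift x y ≫ L.bracket) ≫ iso.hom = lift (x ≫ iso.hom) (y ≫ iso.hom) ≫ L'.bracket

/-! ### Microlinearity of spaces of pointed maps -/

/-- The exchange of variables `A × (B × T) ⟶ B × (A × T)`. -/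
def swap (A B T : E) : A ⊗ (B ⊗ T) ⟶ B ⊗ (A ⊗ T) :=
  lift (snd _ _ ≫ fst _ _) (lift (fst _ _) (snd _ _ ≫ snd _ _))

lemma lift_swap {A B T S : E} (a : S ⟶ A) (b : S ⟶ B) (t : S ⟶ T) :
    lift a (lift b t) ≫ swap A B T = lift b (lift a t) := by
  rw [swap]
  ext <;> simp

lemma lift_swap_assoc {A B T S M : E} (a : S ⟶ A) (b : S ⟶ B) (t : S ⟶ T) (f : B ⊗ (A ⊗ T) ⟶ M) :
    lift a (lift b t) ≫ swap A B T ≫ f = lift b (lift a t) ≫ f := by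
  rw [← Category.assoc, lift_swap]

lemma swap_swap (A B T : E) : swap A B T ≫ swap B A T = 𝟙 _ := by
  simp only [swap]
  ext <;> simp

lemma pt_ext3 {A B T M : E} {f g : A ⊗ (B ⊗ T) ⟶ M}
    (h : ∀ (S : E) (a : S ⟶ A) (b : S ⟶ B) (t : S ⟶ T),
      lift a (lift b t) ≫ f = lift a (lift b t) ≫ g) : f = g := by
  apply pt_ext
  intro S a x
  obtain ⟨b, t, rfl⟩ : ∃ b t, x = lift b t := ⟨x ≫ fst _ _, x ≫ snd _ _, by ext <;> simp⟩
  exact h S a b t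

lemma lift_unc {U X : E} {u₀ : 𝟙_ E ⟶ U} {x₀ : 𝟙_ E ⟶ X} {S T : E} (f : T ⟶ Ptd u₀ x₀)
    (u : S ⟶ U) (t : S ⟶ T) : lift u t ≫ unc f = ap (t ≫ f) u := (ap_comp _ _ _).symm

lemma microlinear_ptd {k : Type w} [CommRing k] {R : E} [CommRingObj R] [AlgObj k R]
    {U X : E} (u₀ : 𝟙_ E ⟶ U) (x₀ : 𝟙_ E ⟶ X) (h : Microlinear k R X) :
    Microlinear k R (Ptd u₀ x₀) := by
  intro J _ _ F c hF hc hR T f hf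
  have H := h J F c hF hc hR
  obtain ⟨g, hg, hu⟩ := H (U ⊗ T) (fun j => swap _ _ _ ≫ unc (f j)) (by
    intro i j a
    rw [← hf a, unc_comp]
    apply pt_ext3
    intro S x u t
    rw [lift_whisker, lift_swap_assoc, lift_swap_assoc, ← Category.assoc (lift u _)]
    congr 1
    ext <;> simp)
  have hb : base u₀ (c.pt ⊗ T) ≫ swap _ _ _ ≫ g = toUnit _ ≫ x₀ := by
    obtain ⟨g', -, hu'⟩ := H T (fun j => toUnit _ ≫ x₀) (by
      intro i j a
      rw [← Category.assoc]; congr 1; exact toUnit_unique _ _)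
    rw [hu' (base u₀ (c.pt ⊗ T) ≫ swap _ _ _ ≫ g), ← hu' (toUnit _ ≫ x₀)]
    · intro j
      rw [← Category.assoc]; congr 1; exact toUnit_unique _ _
    · intro j
      have e := base_unc (f j)
      rw [← e]
      apply pt_ext
      intro S x t
      have h1 : lift x t ≫ base u₀ (F.obj j ⊗ T) ≫ unc (f j) =
          lift (toUnit S ≫ u₀) (lift x t) ≫ unc (f j) := by
        rw [← Category.assoc]
        congr 1
        ext
        · simp
        · simp
        · simp
      have h2 : lift (x ≫ c.ι.app j) t ≫ base u₀ (c.pt ⊗ T) ≫ swap _ _ _ ≫ g =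
          lift (toUnit S ≫ u₀) (lift (x ≫ c.ι.app j) t) ≫ swap _ _ _ ≫ g := by
        rw [← Category.assoc]
        congr 1
        ext
        · simp
        · simp
        · simp
      rw [h1, ← lift_swap_assoc, ← hg j, lift_whisker, lift_whisker, h2, lift_swap_assoc]
  refine ⟨name (swap _ _ _ ≫ g) hb, ?_, ?_⟩
  · intro j
    apply unc_inj
    rw [unc_comp, unc_name]
    apply pt_ext3
    intro S u x t
    have e : lift u (lift x t) ≫ U ◁ (c.ι.app j ▷ T) ≫ swap U c.pt T ≫ g =
        lift u (lift (x ≫ c.ι.app j) t) ≫ swap U c.pt T ≫ g := by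
      rw [← Category.assoc]
      congr 1
      ext <;> simp
    rw [e]
    refine (lift_swap_assoc u (x ≫ c.ι.app j) t g).trans ?_
    refine (lift_whisker (c.ι.app j) g x (lift u t)).symm.trans ?_
    rw [hg j, lift_swap_assoc]
  · intro g' hg'
    apply unc_inj
    rw [unc_name, ← hu (swap _ _ _ ≫ unc g')]
    · rw [← Category.assoc, swap_swap, Category.id_comp]
    · intro j
      rw [← hg' j, unc_comp]
      apply pt_ext3
      intro S x u t
      rw [lift_whisker]
      refine (lift_swap_assoc (x ≫ c.ι.app j) u t (unc g')).trans ?_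
      rw [lift_swap_assoc, ← Category.assoc (lift u _)]
      congr 1
      ext <;> simp

/-! ### The group of pointed maps into a group -/

section

variable {U : E} (u₀ : 𝟙_ E ⟶ U) (G : E) [GrpObj G]

/-- For a group `G` and a pointed object `(U, u₀)`: `{f ∈ G ^ U | f(u₀) = 1}`. -/
abbrev PtdGrp : E := Ptd u₀ η[G]

/-- The neutral element of `{f ∈ G ^ U | f(u₀) = 1}`: the constant map. -/
def PtdGrp.one : 𝟙_ E ⟶ PtdGrp u₀ G := name 1 (by rw [MonObj.comp_one]; rfl)

/-- The pointwise multiplication of `{f ∈ G ^ U | f(u₀) = 1}`. -/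
def PtdGrp.mul : PtdGrp u₀ G ⊗ PtdGrp u₀ G ⟶ PtdGrp u₀ G :=
  name (unc (fst _ _) * unc (snd _ _)) (by
    rw [MonObj.comp_mul, base_unc, base_unc]; exact mul_one (1 : _ ⟶ G))

/-- The pointwise inversion of `{f ∈ G ^ U | f(u₀) = 1}`. -/
def PtdGrp.inv : PtdGrp u₀ G ⟶ PtdGrp u₀ G :=
  name (unc (𝟙 _))⁻¹ (by rw [GrpObj.comp_inv, base_unc]; exact inv_one (G := PtdGrp u₀ G ⟶ G))

variable {u₀ G}

lemma PtdGrp.unc_one {T : E} (s : T ⟶ 𝟙_ E) : unc (s ≫ PtdGrp.one u₀ G) = 1 := by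
  rw [unc_comp, PtdGrp.one, unc_name, MonObj.comp_one]

lemma PtdGrp.unc_mul {T : E} (s : T ⟶ PtdGrp u₀ G ⊗ PtdGrp u₀ G) :
    unc (s ≫ PtdGrp.mul u₀ G) = unc (s ≫ fst _ _) * unc (s ≫ snd _ _) := by
  rw [unc_comp, PtdGrp.mul, unc_name, MonObj.comp_mul, ← unc_comp, ← unc_comp]

lemma PtdGrp.unc_inv {T : E} (s : T ⟶ PtdGrp u₀ G) :
    unc (s ≫ PtdGrp.inv u₀ G) = (unc s)⁻¹ := by
  rw [unc_comp, PtdGrp.inv, unc_name, GrpObj.comp_inv, ← unc_comp, Category.comp_id]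

/-- The pointwise group structure on `{f ∈ G ^ U | f(u₀) = 1}`. -/
instance : GrpObj (PtdGrp u₀ G) where
  one := PtdGrp.one u₀ G
  mul := PtdGrp.mul u₀ G
  inv := PtdGrp.inv u₀ G
  one_mul := unc_inj (by
    rw [PtdGrp.unc_mul, whiskerRight_fst, whiskerRight_snd, PtdGrp.unc_one, one_mul,
      leftUnitor_hom])
  mul_one := unc_inj (by
    rw [PtdGrp.unc_mul, whiskerLeft_fst, whiskerLeft_snd, PtdGrp.unc_one, mul_one,
      rightUnitor_hom])
  mul_assoc := unc_inj (by
    rw [← Category.assoc, PtdGrp.unc_mul, PtdGrp.unc_mul]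
    simp only [whiskerRight_fst, whiskerRight_snd, Category.assoc, whiskerLeft_fst,
      whiskerLeft_snd]
    rw [PtdGrp.unc_mul, ← Category.assoc, PtdGrp.unc_mul]
    simp [mul_assoc])
  left_inv := unc_inj (by
    rw [PtdGrp.unc_mul, lift_fst, lift_snd, PtdGrp.unc_one]
    rw [← Category.id_comp (PtdGrp.inv u₀ G), PtdGrp.unc_inv, inv_mul_cancel])
  right_inv := unc_inj (by
    rw [PtdGrp.unc_mul, lift_fst, lift_snd, PtdGrp.unc_one]
    rw [← Category.id_comp (PtdGrp.inv u₀ G), PtdGrp.unc_inv, mul_inv_cancel])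

end

/-- For a Lie group `G` and a pointed object `(U, u₀)`, the Lie group
`{f ∈ G ^ U | f(u₀) = 1}`, with the pointwise operations. -/
abbrev LieGrp.ptd {k : Type w} [CommRing k] {R : E} [CommRingObj R] [AlgObj k R] (G : LieGrp k R)
    {U : E} (u₀ : 𝟙_ E ⟶ U) : LieGrp k R where
  X := PtdGrp u₀ G.X
  microlinear := microlinear_ptd u₀ _ G.microlinear

/-! ### The tangent space of a group at `1` -/

section

variable (R : E) [CommRingObj R] (G : E) [GrpObj G]

/-- The tangent space of `G` at `1`: `{x ∈ G ^ D | x(0) = 1}`. -/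
def Tan : E := Ptd (zeroD R 1) η[G]

namespace Tan

variable {R G}

/-- The map `D × T ⟶ G` named by a tangent vector. -/
def un {T : E} (x : T ⟶ Tan R G) : D R 1 ⊗ T ⟶ G := unc (u₀ := zeroD R 1) (x₀ := η[G]) x

/-- The tangent vector named by a map `D × T ⟶ G`. -/
def mk {T : E} (g : D R 1 ⊗ T ⟶ G) (h : base (zeroD R 1) T ≫ g = 1) : T ⟶ Tan R G :=
  name (u₀ := zeroD R 1) (x₀ := η[G]) g h

/-- The value `x(d)`. -/
def at' {T : E} (x : T ⟶ Tan R G) (d : T ⟶ D R 1) : T ⟶ G := lift d (𝟙 T) ≫ un x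

lemma un_comp {S T : E} (s : S ⟶ T) (x : T ⟶ Tan R G) : un (s ≫ x) = D R 1 ◁ s ≫ un x :=
  unc_comp s (show T ⟶ Ptd (zeroD R 1) η[G] from x)

@[simp] lemma un_mk {T : E} (g : D R 1 ⊗ T ⟶ G) (h) : un (mk g h) = g := unc_name _ _

lemma un_inj {T : E} {x y : T ⟶ Tan R G} (h : un x = un y) : x = y :=
  unc_inj (u₀ := zeroD R 1) (x₀ := η[G]) h

lemma base_un {T : E} (x : T ⟶ Tan R G) : base (zeroD R 1) T ≫ un x = 1 :=
  base_unc (show T ⟶ Ptd (zeroD R 1) η[G] from x)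

lemma comp_at {S T : E} (s : S ⟶ T) (x : T ⟶ Tan R G) (d : T ⟶ D R 1) :
    s ≫ at' x d = at' (s ≫ x) (s ≫ d) :=
  comp_ap s (show T ⟶ Ptd (zeroD R 1) η[G] from x) d

lemma at_comp {S T : E} (s : S ⟶ T) (x : T ⟶ Tan R G) (d : S ⟶ D R 1) :
    at' (s ≫ x) d = lift d s ≫ un x :=
  ap_comp s (show T ⟶ Ptd (zeroD R 1) η[G] from x) d

@[simp] lemma at_mk {S T : E} (s : S ⟶ T) (g : D R 1 ⊗ T ⟶ G) (h) (d : S ⟶ D R 1) :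
    at' (s ≫ mk g h) d = lift d s ≫ g := by rw [at_comp, un_mk]

lemma ext {T : E} {x y : T ⟶ Tan R G}
    (h : ∀ (S : E) (s : S ⟶ T) (d : S ⟶ D R 1), at' (s ≫ x) d = at' (s ≫ y) d) : x = y :=
  ptd_ext (u₀ := zeroD R 1) (x₀ := η[G]) h

lemma at_zero {T : E} (x : T ⟶ Tan R G) {d : T ⟶ D R 1} (h : d ≫ incl R 1 = 0) : at' x d = 1 :=
  ap_zero (show T ⟶ Ptd (zeroD R 1) η[G] from x) d (eq_zD h)

variable (R G)

/-- The zero tangent vector. -/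
def zero : 𝟙_ E ⟶ Tan R G := mk 1 (MonObj.comp_one _)

/-- Addition of tangent vectors: `(x + y)(d) = x(d) y(d)`. -/
def add : Tan R G ⊗ Tan R G ⟶ Tan R G :=
  mk (un (fst _ _) * un (snd _ _)) (by
    rw [MonObj.comp_mul, base_un, base_un, mul_one])

/-- The opposite of a tangent vector: `(-x)(d) = x(d)⁻¹`. -/
def neg : Tan R G ⟶ Tan R G :=
  mk (un (𝟙 _))⁻¹ (by rw [GrpObj.comp_inv, base_un, inv_one])

/-- Scalar multiplication of tangent vectors: `(r x)(d) = x(r d)`. -/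
def smul : R ⊗ Tan R G ⟶ Tan R G :=
  mk (at' (snd (D R 1) _ ≫ snd R (Tan R G)) (scaleD (snd (D R 1) _ ≫ fst R (Tan R G)) (fst _ _))) (by
    rw [comp_at, at_zero]
    rw [comp_scaleD, scaleD_incl, lift_fst, zeroD_incl', mul_zero])

variable {R G}

lemma at_zero' {T : E} (s : T ⟶ 𝟙_ E) (d : T ⟶ D R 1) : at' (s ≫ zero R G) d = 1 := by
  rw [zero, at_mk, MonObj.comp_one]

lemma at_add' {T : E} (p : T ⟶ Tan R G ⊗ Tan R G) (d : T ⟶ D R 1) :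
    at' (p ≫ add R G) d = at' (p ≫ fst _ _) d * at' (p ≫ snd _ _) d := by
  rw [add, at_mk, MonObj.comp_mul, ← at_comp, ← at_comp]

lemma at_neg' {T : E} (x : T ⟶ Tan R G) (d : T ⟶ D R 1) :
    at' (x ≫ neg R G) d = (at' x d)⁻¹ := by
  rw [neg, at_mk, GrpObj.comp_inv, ← at_comp, Category.comp_id]

lemma at_smul' {T : E} (p : T ⟶ R ⊗ Tan R G) (d : T ⟶ D R 1) :
    at' (p ≫ smul R G) d = at' (p ≫ snd _ _) (scaleD (p ≫ fst _ _) d) := by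
  rw [smul, at_mk, comp_at, comp_scaleD]
  simp

/-- The addition of tangent vectors. -/
instance : AddGrpObj (Tan R G) where
  zero := zero R G
  add := add R G
  neg := neg R G
  zero_add := ext fun S s d => by
    rw [← Category.assoc, at_add']
    simp only [Category.assoc, whiskerRight_fst, whiskerRight_snd]
    rw [← Category.assoc, at_zero', one_mul, leftUnitor_hom]
  add_zero := ext fun S s d => by
    rw [← Category.assoc, at_add']
    simp only [Category.assoc, whiskerLeft_fst, whiskerLeft_snd]
    rw [← Category.assoc s (snd _ _), at_zero', mul_one, rightUnitor_hom]
  add_assoc := ext fun S s d => by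
    simp only [← Category.assoc, at_add']
    simp only [Category.assoc, whiskerRight_fst, whiskerRight_snd, whiskerLeft_fst,
      whiskerLeft_snd, associator_hom_fst]
    rw [← Category.assoc s (fst _ _) (add R G), at_add',
      show s ≫ (α_ _ _ _).hom ≫ snd _ _ ≫ add R G = (s ≫ (α_ _ _ _).hom ≫ snd _ _) ≫ add R G by
        simp only [Category.assoc], at_add']
    simp [mul_assoc]
  left_neg := ext fun S s d => by
    rw [← Category.assoc, at_add', ← Category.assoc, at_zero']
    simp only [Category.assoc, lift_fst, lift_snd]
    rw [at_neg', Category.comp_id, inv_mul_cancel]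
  right_neg := ext fun S s d => by
    rw [← Category.assoc, at_add', ← Category.assoc, at_zero']
    simp only [Category.assoc, lift_fst, lift_snd]
    rw [at_neg', Category.comp_id, mul_inv_cancel]

lemma at_add {T : E} (x y : T ⟶ Tan R G) (d : T ⟶ D R 1) :
    at' (x + y) d = at' x d * at' y d := by
  rw [Hom.add_def]
  exact (at_add' (lift x y) d).trans (by rw [lift_fst, lift_snd])

lemma at_zz {T : E} (d : T ⟶ D R 1) : at' (0 : T ⟶ Tan R G) d = 1 := by
  rw [Hom.zero_def]
  exact at_zero' _ _

lemma at_neg {T : E} (x : T ⟶ Tan R G) (d : T ⟶ D R 1) : at' (-x) d = (at' x d)⁻¹ := by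
  rw [Hom.neg_def]
  exact at_neg' x d

/-- The action of the line on tangent vectors. -/
instance : ModObj R (Tan R G) where
  smul := smul R G
  one_smul := ext fun S s d => by
    change at' (s ≫ η ▷ Tan R G ≫ smul R G) d = at' (s ≫ (λ_ (Tan R G)).hom) d
    rw [← Category.assoc, at_smul', Category.assoc, Category.assoc, whiskerRight_fst,
      whiskerRight_snd, leftUnitor_hom]
    congr 1
    apply D_ext
    rw [scaleD_incl, ← Category.assoc, toUnit_unique (s ≫ fst _ _) (toUnit S), ← Hom.one_def,
      one_mul]
  mul_smul := ext fun S s d => by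
    change at' (s ≫ μ ▷ Tan R G ≫ smul R G) d =
      at' (s ≫ (α_ R R (Tan R G)).hom ≫ R ◁ smul R G ≫ smul R G) d
    simp only [← Category.assoc, at_smul']
    simp only [Category.assoc, whiskerRight_fst, whiskerRight_snd, whiskerLeft_fst,
      whiskerLeft_snd, associator_hom_fst]
    simp only [← Category.assoc, at_smul']
    simp only [Category.assoc, associator_hom_snd_fst, associator_hom_snd_snd]
    congr 1
    apply D_ext
    rw [scaleD_incl, scaleD_incl, scaleD_incl, ← mul_assoc, mul_comm (s ≫ fst _ _ ≫ snd _ _)]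
    congr 1
    rw [Hom.mul_def, ← Category.assoc]
    congr 1
    ext <;> simp

lemma at_smul {T : E} (r : T ⟶ R) (x : T ⟶ Tan R G) (d : T ⟶ D R 1) :
    at' (r • x) d = at' x (scaleD r d) := by
  rw [Hom.smul_def]
  exact (at_smul' (lift r x) d).trans (by rw [lift_fst, lift_snd])

end Tan

end

/-! ### The Lie algebra of a Lie group -/

namespace Tan

variable {R : E} [CommRingObj R] {G : E} [GrpObj G]

/-- The element `-d` of `D`. -/
def negD {T : E} (d : T ⟶ D R 1) : T ⟶ D R 1 := scaleD (-1) d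

lemma negD_incl {T : E} (d : T ⟶ D R 1) : negD d ≫ incl R 1 = -(d ≫ incl R 1) := by
  rw [negD, scaleD_incl, neg_one_mul]

lemma comp_negD {S T : E} (s : S ⟶ T) (d : T ⟶ D R 1) : s ≫ negD d = negD (s ≫ d) := by
  apply D_ext
  rw [negD_incl, Category.assoc, negD_incl, Category.assoc]
  exact map_neg (pull R s) _

/-- The sum of two elements of `D` with product zero. -/
def sumD {T : E} (d d' : T ⟶ D R 1) (h : (d ≫ incl R 1) * (d' ≫ incl R 1) = 0) : T ⟶ D R 1 :=
  toD (d ≫ incl R 1 + d' ≫ incl R 1) (by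
    have e : (d ≫ incl R 1 + d' ≫ incl R 1) ^ (1 + 1) = (d ≫ incl R 1) ^ (1 + 1) +
      (d' ≫ incl R 1) ^ (1 + 1) + 2 * ((d ≫ incl R 1) * (d' ≫ incl R 1)) := by ring
    rw [e, incl_pow, incl_pow, h]
    simp)

lemma sumD_incl {T : E} (d d' : T ⟶ D R 1) (h : (d ≫ incl R 1) * (d' ≫ incl R 1) = 0) :
    sumD d d' h ≫ incl R 1 = d ≫ incl R 1 + d' ≫ incl R 1 := toD_incl _ _

/-- The first coordinate on `D(2)`. -/
abbrev dd1 (R : E) [CommRingObj R] (T : E) : DD R ⊗ T ⟶ D R 1 := fst _ _ ≫ DDincl R ≫ fst _ _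

/-- The second coordinate on `D(2)`. -/
abbrev dd2 (R : E) [CommRingObj R] (T : E) : DD R ⊗ T ⟶ D R 1 := fst _ _ ≫ DDincl R ≫ snd _ _

lemma dd_mul (T : E) : (dd1 R T ≫ incl R 1) * (dd2 R T ≫ incl R 1) = 0 := DD_mul (fst (DD R) T)

lemma comp_dd1 {S T : E} (d d' : S ⟶ D R 1) (h) (t : S ⟶ T) :
    lift (toDD d d' h) t ≫ dd1 R T = d := by
  rw [lift_fst_assoc, ← Category.assoc, toDD_incl, lift_fst]

lemma comp_dd2 {S T : E} (d d' : S ⟶ D R 1) (h) (t : S ⟶ T) :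
    lift (toDD d d' h) t ≫ dd2 R T = d' := by
  rw [lift_fst_assoc, ← Category.assoc, toDD_incl, lift_snd]

variable {k : Type w} [CommRing k] [AlgObj k R] [KockLawvere k R]

/-- Two maps on `D(2)` agreeing on the axes are equal. -/
lemma dd_ext (hG : Microlinear k R G) {T : E} {f g : DD R ⊗ T ⟶ G}
    (h1 : ∀ (S : E) (d : S ⟶ D R 1) (h) (t : S ⟶ T),
      lift (toDD d (zD R S) h) t ≫ f = lift (toDD d (zD R S) h) t ≫ g)
    (h2 : ∀ (S : E) (d : S ⟶ D R 1) (h) (t : S ⟶ T),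
      lift (toDD (zD R S) d h) t ≫ f = lift (toDD (zD R S) d h) t ≫ g) : f = g := by
  apply micro_DD hG
  · apply pt_ext
    intro S d t
    rw [lift_whisker, lift_whisker, comp_axis1]
    exact h1 S d _ t
  · apply pt_ext
    intro S d t
    rw [lift_whisker, lift_whisker, comp_axis2]
    exact h2 S d _ t

lemma at_comm (hG : Microlinear k R G) {T : E} (x y : T ⟶ Tan R G) (d d' : T ⟶ D R 1)
    (h : (d ≫ incl R 1) * (d' ≫ incl R 1) = 0) : at' x d * at' y d' = at' y d' * at' x d := by
  have e : at' (snd _ _ ≫ x) (dd1 R T) * at' (snd _ _ ≫ y) (dd2 R T) =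
      at' (snd _ _ ≫ y) (dd2 R T) * at' (snd _ _ ≫ x) (dd1 R T) := by
    apply dd_ext hG <;> intro S d h t <;>
    simp only [MonObj.comp_mul, comp_at, comp_dd1, comp_dd2, lift_snd_assoc, at_zero _ zD_incl,
      one_mul, mul_one]
  have := congrArg (fun f => lift (toDD d d' h) (𝟙 T) ≫ f) e
  simpa only [MonObj.comp_mul, comp_at, comp_dd1, comp_dd2, lift_snd_assoc, Category.id_comp]
    using this

lemma at_sum (hG : Microlinear k R G) {T : E} (x : T ⟶ Tan R G) (d d' : T ⟶ D R 1)
    (h : (d ≫ incl R 1) * (d' ≫ incl R 1) = 0) :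
    at' x (sumD d d' h) = at' x d * at' x d' := by
  have cs : ∀ {S : E} (s : S ⟶ DD R ⊗ T) {d : S ⟶ D R 1},
      (s ≫ dd1 R T) ≫ incl R 1 + (s ≫ dd2 R T) ≫ incl R 1 = d ≫ incl R 1 →
      s ≫ sumD (dd1 R T) (dd2 R T) (dd_mul T) = d := by
    intro S s d hd
    apply D_ext
    rw [Category.assoc, sumD_incl, comp_add', ← Category.assoc s (dd1 R T), ← Category.assoc s (dd2 R T), hd]
  have e : at' (snd _ _ ≫ x) (sumD (dd1 R T) (dd2 R T) (dd_mul T)) =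
      at' (snd _ _ ≫ x) (dd1 R T) * at' (snd _ _ ≫ x) (dd2 R T) := by
    apply dd_ext hG <;> intro S d h t
    · rw [MonObj.comp_mul, comp_at, comp_at, comp_at, comp_dd1, comp_dd2,
        at_zero _ (zD_incl (R := R)), mul_one, cs (d := d)]
      rw [comp_dd1, comp_dd2, zD_incl, add_zero]
    · rw [MonObj.comp_mul, comp_at, comp_at, comp_at, comp_dd1, comp_dd2,
        at_zero _ (zD_incl (R := R)), one_mul, cs (d := d)]
      rw [comp_dd1, comp_dd2, zD_incl, zero_add]
  have := congrArg (fun f => lift (toDD d d' h) (𝟙 T) ≫ f) e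
  rw [MonObj.comp_mul, comp_at, comp_at, comp_at, comp_dd1, comp_dd2, lift_snd_assoc,
    Category.id_comp, cs (d := sumD d d' h)] at this
  · exact this
  · rw [comp_dd1, comp_dd2, sumD_incl]

/-- Addition of tangent vectors is the addition determined by the functions on `D(2)`. -/
lemma at_add_unique (hG : Microlinear k R G) {T : E} (x y : T ⟶ Tan R G) (l : DD R ⊗ T ⟶ G)
    (h1 : ∀ (S : E) (s : S ⟶ T) (d : S ⟶ D R 1) (h),
      lift (toDD d (zD R S) h) s ≫ l = at' (s ≫ x) d)
    (h2 : ∀ (S : E) (s : S ⟶ T) (d : S ⟶ D R 1) (h),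
      lift (toDD (zD R S) d h) s ≫ l = at' (s ≫ y) d) {S : E} (s : S ⟶ T) (d : S ⟶ D R 1) :
    lift (toDD d d (incl_sq d)) s ≫ l = at' (s ≫ (x + y)) d := by
  have e : l = at' (snd _ _ ≫ x) (dd1 R T) * at' (snd _ _ ≫ y) (dd2 R T) := by
    apply dd_ext hG <;> intro S d h t
    · rw [h1]
      simp only [MonObj.comp_mul, comp_at, comp_dd1, comp_dd2, lift_snd_assoc, at_zero _ zD_incl,
        mul_one]
    · rw [h2]
      simp only [MonObj.comp_mul, comp_at, comp_dd1, comp_dd2, lift_snd_assoc, at_zero _ zD_incl,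
        one_mul]
  rw [AddMonObj.comp_add, at_add, e, MonObj.comp_mul, comp_at, comp_at, comp_dd1, comp_dd2,
    lift_snd_assoc, lift_snd_assoc]

lemma at_negD (hG : Microlinear k R G) {T : E} (x : T ⟶ Tan R G) (d : T ⟶ D R 1) :
    at' x (negD d) = (at' x d)⁻¹ := by
  have h : (negD d ≫ incl R 1) * (d ≫ incl R 1) = 0 := by
    rw [negD_incl, neg_mul, incl_sq, neg_zero]
  rw [eq_inv_iff_mul_eq_one, ← at_sum hG x _ _ h, at_zero]
  rw [sumD_incl, negD_incl, neg_add_cancel]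

lemma ext1 {T : E} {x y : T ⟶ Tan R G}
    (h : ∀ (S : E) (s : S ⟶ T) (d : S ⟶ D R 1), at' (s ≫ x) d = at' (s ≫ y) d) : x = y := ext h

/-- Factorization through the multiplication of `D`. -/
lemma exists_mul (hG : Microlinear k R G) {T : E} (f : (D R 1 ⊗ D R 1) ⊗ T ⟶ G)
    (h1 : ∀ (S : E) (d : S ⟶ D R 1) (t : S ⟶ T), lift (lift d (zD R S)) t ≫ f = 1)
    (h2 : ∀ (S : E) (d : S ⟶ D R 1) (t : S ⟶ T), lift (lift (zD R S) d) t ≫ f = 1) :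
    ∃ z : T ⟶ Tan R G, ∀ (S : E) (s : S ⟶ T) (d d' : S ⟶ D R 1),
      at' (s ≫ z) (mulD d d') = lift (lift d d') s ≫ f := by
  obtain ⟨h, hh, -⟩ := micro_mul hG f 1 (by simpa only [MonObj.comp_one] using h1)
    (by simpa only [MonObj.comp_one] using h2)
  refine ⟨mk h ?_, fun S s d d' => ?_⟩
  · rw [← h1 T (zD R T) (𝟙 T), ← hh]
    congr 1
    refine congrArg (fun d => lift d (𝟙 T)) ?_
    apply D_ext
    rw [zeroD_incl', mulD_incl, zD_incl, zero_mul]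
  · rw [at_mk, hh]

lemma mul_cancel (hG : Microlinear k R G) {T : E} {x y : T ⟶ Tan R G}
    (h : ∀ (S : E) (s : S ⟶ T) (d d' : S ⟶ D R 1),
      at' (s ≫ x) (mulD d d') = at' (s ≫ y) (mulD d d')) : x = y := by
  obtain ⟨g, -, hu⟩ := micro_mul hG
    (at' (snd _ _ ≫ x) (mulD (fst (D R 1 ⊗ D R 1) T ≫ fst _ _) (fst _ _ ≫ snd _ _))) 1 (by
      intro S d t
      rw [MonObj.comp_one, comp_at, at_zero]
      rw [comp_mulD, mulD_incl, lift_fst_assoc, lift_fst_assoc, lift_snd, zD_incl, mul_zero]) (by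
      intro S d t
      rw [MonObj.comp_one, comp_at, at_zero]
      rw [comp_mulD, mulD_incl, lift_fst_assoc, lift_fst_assoc, lift_fst, zD_incl, zero_mul])
  apply un_inj
  rw [hu (un x), hu (un y)]
  · intro S d d' t
    rw [comp_at, comp_mulD, lift_fst_assoc, lift_fst_assoc, lift_fst, lift_snd, lift_snd_assoc,
      ← at_comp, h]
  · intro S d d' t
    rw [comp_at, comp_mulD, lift_fst_assoc, lift_fst_assoc, lift_fst, lift_snd, lift_snd_assoc,
      ← at_comp]

lemma mul_cancel2 (hG : Microlinear k R G) {T : E} {x y : T ⟶ Tan R G}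
    (h : ∀ (S : E) (s : S ⟶ T) (d₁ d₂ d₃ : S ⟶ D R 1),
      at' (s ≫ x) (mulD d₁ (mulD d₂ d₃)) = at' (s ≫ y) (mulD d₁ (mulD d₂ d₃))) : x = y := by
  have e : (fst (D R 1) T ≫ incl R 1) • (snd (D R 1) T ≫ x) =
      (fst (D R 1) T ≫ incl R 1) • (snd (D R 1) T ≫ y) := by
    apply mul_cancel hG
    intro S s d d'
    have key : ∀ x : T ⟶ Tan R G,
        at' (s ≫ ((fst (D R 1) T ≫ incl R 1) • (snd (D R 1) T ≫ x))) (mulD d d') =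
        at' ((s ≫ snd _ _) ≫ x) (mulD (s ≫ fst _ _) (mulD d d')) := by
      intro x
      rw [ModObj.comp_smul, at_smul, Category.assoc]
      congr 1
      apply D_ext
      rw [scaleD_incl, mulD_incl, mulD_incl, mulD_incl, Category.assoc]
    rw [key, key, h]
  apply mul_cancel hG
  intro S s d d'
  have := congrArg (fun f => at' (lift d s ≫ f) d') e
  have key : ∀ x : T ⟶ Tan R G,
      at' (lift d s ≫ ((fst (D R 1) T ≫ incl R 1) • (snd (D R 1) T ≫ x))) d' =
        at' (s ≫ x) (mulD d d') := by
    intro x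
    rw [ModObj.comp_smul, at_smul, lift_snd_assoc, lift_fst_assoc]
    congr 1
  rwa [key, key] at this

end Tan

namespace Tan

section

variable {R : E} [CommRingObj R] {G : E} [GrpObj G]
  {k : Type w} [CommRing k] [AlgObj k R] [KockLawvere k R]

lemma comm_add (hG : Microlinear k R G) : IsCommAddMonObj (Tan R G) where
  add_comm := by
    apply ext
    intro S s d
    change at' (s ≫ (β_ _ _).hom ≫ add R G) d = at' (s ≫ add R G) d
    rw [← Category.assoc, at_add', at_add', Category.assoc, Category.assoc]
    have h1 : (β_ (Tan R G) (Tan R G)).hom ≫ fst _ _ = snd _ _ := by simp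
    have h2 : (β_ (Tan R G) (Tan R G)).hom ≫ snd _ _ = fst _ _ := by simp
    rw [h1, h2]
    exact at_comm hG _ _ _ _ (incl_sq d)

lemma smul_add' {T : E} (r : T ⟶ R) (x y : T ⟶ Tan R G) : r • (x + y) = r • x + r • y := by
  apply ext
  intro S s d
  simp only [ModObj.comp_smul, AddMonObj.comp_add, at_smul, at_add]

lemma add_smul' (hG : Microlinear k R G) {T : E} (r r' : T ⟶ R) (x : T ⟶ Tan R G) :
    (r + r') • x = r • x + r' • x := by
  apply ext
  intro S s d
  simp only [ModObj.comp_smul, AddMonObj.comp_add, at_smul, at_add]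
  rw [← at_sum hG]
  · congr 1
    apply D_ext
    rw [scaleD_incl, sumD_incl, scaleD_incl, scaleD_incl, add_mul]
  · rw [scaleD_incl, scaleD_incl, mul_mul_mul_comm, incl_sq, mul_zero]

variable (R G) in
/-- The map `(d, d') ↦ x(d) y(d') x(-d) y(-d')`, depending on tangent vectors `x`, `y`. -/
def commutator : (D R 1 ⊗ D R 1) ⊗ (Tan R G ⊗ Tan R G) ⟶ G :=
  at' (snd _ _ ≫ fst _ _) (fst _ _ ≫ fst _ _) * at' (snd _ _ ≫ snd _ _) (fst _ _ ≫ snd _ _) *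
    at' (snd _ _ ≫ fst _ _) (negD (fst _ _ ≫ fst _ _)) *
    at' (snd _ _ ≫ snd _ _) (negD (fst _ _ ≫ snd _ _))

lemma comp_commutator {S : E} (d d' : S ⟶ D R 1) (p : S ⟶ Tan R G ⊗ Tan R G) :
    lift (lift d d') p ≫ commutator R G = at' (p ≫ fst _ _) d * at' (p ≫ snd _ _) d' *
      at' (p ≫ fst _ _) (negD d) * at' (p ≫ snd _ _) (negD d') := by
  simp only [commutator, MonObj.comp_mul, comp_at, comp_negD, lift_snd_assoc, lift_fst_assoc,
    lift_fst, lift_snd]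

lemma bracket_ex (hG : Microlinear k R G) : ∃ z : Tan R G ⊗ Tan R G ⟶ Tan R G,
    ∀ (S : E) (s : S ⟶ Tan R G ⊗ Tan R G) (d d' : S ⟶ D R 1),
      at' (s ≫ z) (mulD d d') = lift (lift d d') s ≫ commutator R G := by
  apply exists_mul hG
  · intro S d t
    rw [comp_commutator, at_negD hG, at_negD hG, at_zero _ (zD_incl (R := R))]
    group
  · intro S d t
    rw [comp_commutator, at_negD hG, at_negD hG, at_zero _ (zD_incl (R := R))]
    group

/-- The bracket of tangent vectors, characterized by
`[x, y](d d') = x(d) y(d') x(-d) y(-d')`. -/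
def bracket (hG : Microlinear k R G) : Tan R G ⊗ Tan R G ⟶ Tan R G := (bracket_ex hG).choose

lemma at_bracket (hG : Microlinear k R G) {T : E} (x y : T ⟶ Tan R G) (d d' : T ⟶ D R 1) :
    at' (lift x y ≫ bracket hG) (mulD d d') =
      at' x d * at' y d' * at' x (negD d) * at' y (negD d') := by
  rw [bracket, (bracket_ex hG).choose_spec, comp_commutator, lift_fst, lift_snd]

lemma at_bracket' (hG : Microlinear k R G) {T : E} (x y : T ⟶ Tan R G) (d d' : T ⟶ D R 1) :
    at' (lift x y ≫ bracket hG) (mulD d d') =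
      at' x d * at' y d' * (at' x d)⁻¹ * (at' y d')⁻¹ := by
  rw [at_bracket, at_negD hG, at_negD hG]

lemma mulD_comm {T : E} (d d' : T ⟶ D R 1) : mulD d d' = mulD d' d := by
  apply D_ext
  rw [mulD_incl, mulD_incl, mul_comm]

lemma bracket_antisymm (hG : Microlinear k R G) {T : E} (x y : T ⟶ Tan R G) :
    lift x y ≫ bracket hG = -(lift y x ≫ bracket hG) := by
  apply mul_cancel hG
  intro S s d d'
  have e : s ≫ (-(lift y x ≫ bracket hG)) = -(s ≫ lift y x ≫ bracket hG) :=
    AddGrpObj.comp_neg _ _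
  rw [e, at_neg, ← Category.assoc, ← Category.assoc, comp_lift, comp_lift, at_bracket' hG,
    mulD_comm, at_bracket' hG]
  group

lemma add_bracket (hG : Microlinear k R G) {T : E} (x y z : T ⟶ Tan R G) :
    lift (x + y) z ≫ bracket hG = lift x z ≫ bracket hG + lift y z ≫ bracket hG := by
  apply mul_cancel hG
  intro S s d d'
  rw [AddMonObj.comp_add, at_add]
  simp only [← Category.assoc, comp_lift]
  rw [AddMonObj.comp_add]
  have h := at_comm hG (s ≫ x) (lift (s ≫ y) (s ≫ z) ≫ bracket hG) d (mulD d d') (by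
    rw [mulD_incl, ← mul_assoc, incl_sq, zero_mul])
  have h' := at_comm hG (lift (s ≫ x) (s ≫ z) ≫ bracket hG)
    (lift (s ≫ y) (s ≫ z) ≫ bracket hG) _ _ (incl_sq (mulD d d'))
  rw [h', at_bracket' hG, at_add]
  rw [at_bracket' hG] at h
  rw [at_bracket' hG, at_bracket' hG]
  have e : ∀ a b c : S ⟶ G, a * (b * c * b⁻¹ * c⁻¹) = (b * c * b⁻¹ * c⁻¹) * a →
      a * b * c * (a * b)⁻¹ * c⁻¹ = b * c * b⁻¹ * c⁻¹ * (a * c * a⁻¹ * c⁻¹) := by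
    intro a b c h
    have : a * b * c * (a * b)⁻¹ * c⁻¹ =
      (a * (b * c * b⁻¹ * c⁻¹)) * (c * a⁻¹ * c⁻¹) := by group
    rw [this, h]
    group
  exact e _ _ _ h

lemma smul_bracket (hG : Microlinear k R G) {T : E} (r : T ⟶ R) (x y : T ⟶ Tan R G) :
    lift (r • x) y ≫ bracket hG = r • (lift x y ≫ bracket hG) := by
  apply mul_cancel hG
  intro S s d d'
  rw [ModObj.comp_smul, at_smul]
  simp only [← Category.assoc, comp_lift]
  have e : scaleD (s ≫ r) (mulD d d') = mulD (scaleD (s ≫ r) d) d' := by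
    apply D_ext
    rw [scaleD_incl, mulD_incl, mulD_incl, scaleD_incl, mul_assoc]
  rw [e, ModObj.comp_smul, at_bracket' hG, at_bracket' hG, at_smul]

lemma bracket_add (hG : Microlinear k R G) {T : E} (x y z : T ⟶ Tan R G) :
    lift x (y + z) ≫ bracket hG = lift x y ≫ bracket hG + lift x z ≫ bracket hG := by
  have := comm_add hG
  rw [bracket_antisymm, add_bracket, neg_add, ← bracket_antisymm, ← bracket_antisymm]

lemma smul_neg' {T : E} (r : T ⟶ R) (x : T ⟶ Tan R G) : r • (-x) = -(r • x) := by
  rw [eq_neg_iff_add_eq_zero, ← smul_add', neg_add_cancel]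
  apply ext
  intro S s d
  have e : s ≫ (0 : T ⟶ Tan R G) = 0 := AddMonObj.comp_zero _
  rw [ModObj.comp_smul, at_smul, e, at_zz, at_zz]

lemma bracket_smul (hG : Microlinear k R G) {T : E} (r : T ⟶ R) (x y : T ⟶ Tan R G) :
    lift x (r • y) ≫ bracket hG = r • (lift x y ≫ bracket hG) := by
  rw [bracket_antisymm, smul_bracket, bracket_antisymm hG x y, smul_neg']

lemma jacobi (hG : Microlinear k R G) {T : E} (x y z : T ⟶ Tan R G) :
    lift x (lift y z ≫ bracket hG) ≫ bracket hG + lift y (lift z x ≫ bracket hG) ≫ bracket hG +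
      lift z (lift x y ≫ bracket hG) ≫ bracket hG = 0 := by
  have := comm_add hG
  rw [bracket_antisymm hG x (lift y z ≫ _), bracket_antisymm hG y (lift z x ≫ _),
    bracket_antisymm hG z (lift x y ≫ _), ← neg_add, ← neg_add,
    neg_eq_zero]
  apply mul_cancel2 hG
  intro S s d₁ d₂ d₃
  have e0 : s ≫ (0 : T ⟶ Tan R G) = 0 := AddMonObj.comp_zero _
  rw [e0, at_zz, AddMonObj.comp_add, AddMonObj.comp_add]
  simp only [← Category.assoc, comp_lift]
  generalize s ≫ x = x
  generalize s ≫ y = y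
  generalize s ≫ z = z
  have hc : ∀ (x y z : S ⟶ Tan R G) (e₁ e₂ e₃ : S ⟶ D R 1),
      mulD (mulD (negD e₁) e₂) e₃ = negD (mulD d₁ (mulD d₂ d₃)) →
      at' (lift (lift x y ≫ bracket hG) z ≫ bracket hG) (negD (mulD d₁ (mulD d₂ d₃))) =
      ((at' x e₁)⁻¹ * at' y e₂ * at' x e₁ * (at' y e₂)⁻¹) * at' z e₃ *
      ((at' x e₁)⁻¹ * at' y e₂ * at' x e₁ * (at' y e₂)⁻¹)⁻¹ * (at' z e₃)⁻¹ := by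
    intro x y z e₁ e₂ e₃ h
    rw [← h, at_bracket' hG, at_bracket' hG, at_negD hG, inv_inv]
  have hX := hc y z x d₂ d₃ d₁ (by
    apply D_ext
    simp only [mulD_incl, negD_incl]
    ring)
  have hY := hc z x y d₃ d₁ d₂ (by
    apply D_ext
    simp only [mulD_incl, negD_incl]
    ring)
  have hZ := hc x y z d₁ d₂ d₃ (by
    apply D_ext
    simp only [mulD_incl, negD_incl]
    ring)
  clear hc
  generalize lift (lift y z ≫ bracket hG) x ≫ bracket hG = X at *
  generalize lift (lift z x ≫ bracket hG) y ≫ bracket hG = Y at *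
  generalize lift (lift x y ≫ bracket hG) z ≫ bracket hG = Z at *
  have c1 : ∀ (w w' : S ⟶ Tan R G) (d : S ⟶ D R 1),
      (d ≫ incl R 1) * ((d₁ ≫ incl R 1) * ((d₂ ≫ incl R 1) * (d₃ ≫ incl R 1))) = 0 →
      at' w d * at' w' (negD (mulD d₁ (mulD d₂ d₃))) * (at' w d)⁻¹ =
        at' w' (negD (mulD d₁ (mulD d₂ d₃))) := by
    intro w w' d hd
    rw [at_comm hG, mul_inv_cancel_right]
    rw [negD_incl, mulD_incl, mulD_incl, mul_neg, hd, neg_zero]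
  have hZ' := c1 x Z d₁ (by rw [← mul_assoc, incl_sq, zero_mul])
  have hY' := c1 z Y d₃ (by
    rw [mul_left_comm, mul_left_comm (d₃ ≫ incl R 1), incl_sq, mul_zero, mul_zero])
  have hX' := c1 y X d₂ (by
    rw [mul_left_comm, ← mul_assoc (d₂ ≫ incl R 1), incl_sq, zero_mul, mul_zero])
  have key : at' (Z + Y + X) (negD (mulD d₁ (mulD d₂ d₃))) = 1 := by
    rw [at_add, at_add, ← hX', ← hY', ← hZ', hX, hY, hZ]
    group
  rw [at_negD hG, inv_eq_one] at key
  rw [← key]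
  congr 1
  abel

lemma euclidean (hG : Microlinear k R G) {T : E} (f : D R 1 ⊗ T ⟶ Tan R G) :
    ∃! p : (T ⟶ Tan R G) × (T ⟶ Tan R G),
    f = snd (D R 1) T ≫ p.1 + (fst (D R 1) T ≫ incl R 1) • (snd (D R 1) T ≫ p.2) := by
  have key : ∀ (b : T ⟶ Tan R G) {S : E} (t : S ⟶ T) (d e : S ⟶ D R 1),
      at' (lift d t ≫ ((fst (D R 1) T ≫ incl R 1) • (snd (D R 1) T ≫ b))) e =
        at' (t ≫ b) (mulD d e) := by
    intro b S t d e
    rw [ModObj.comp_smul, at_smul, lift_snd_assoc, lift_fst_assoc]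
    congr 1
  have val : ∀ (a b : T ⟶ Tan R G) {S : E} (t : S ⟶ T) (d e : S ⟶ D R 1),
      at' (lift d t ≫ (snd (D R 1) T ≫ a +
        (fst (D R 1) T ≫ incl R 1) • (snd (D R 1) T ≫ b))) e =
        at' (t ≫ a) e * at' (t ≫ b) (mulD d e) := by
    intro a b S t d e
    rw [AddMonObj.comp_add, at_add, key, lift_snd_assoc]
  have z1 : ∀ {S : E} (d : S ⟶ D R 1), mulD (zD R S) d ≫ incl R 1 = 0 := by
    intro S d
    rw [mulD_incl, zD_incl, zero_mul]
  obtain ⟨a, ha⟩ : ∃ a : T ⟶ Tan R G, ∀ (S : E) (t : S ⟶ T), t ≫ a = lift (zD R S) t ≫ f :=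
    ⟨lift (zD R T) (𝟙 T) ≫ f, fun S t => by
      rw [← Category.assoc, comp_lift, comp_zD, Category.comp_id]⟩
  obtain ⟨b, hb⟩ := exists_mul hG
    ((at' (snd (D R 1 ⊗ D R 1) T ≫ a) (fst _ _ ≫ snd _ _))⁻¹ *
      at' (lift (fst (D R 1 ⊗ D R 1) T ≫ fst _ _) (snd _ _) ≫ f) (fst _ _ ≫ snd _ _)) (by
      intro S d t
      rw [MonObj.comp_mul, GrpObj.comp_inv, comp_at, comp_at, lift_fst_assoc, lift_snd,
        at_zero _ (zD_incl (R := R)), at_zero _ (zD_incl (R := R)), inv_one, mul_one]) (by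
      intro S d t
      rw [MonObj.comp_mul, GrpObj.comp_inv, comp_at, comp_at, lift_fst_assoc, lift_snd,
        lift_snd_assoc, ← Category.assoc, comp_lift, lift_snd, lift_fst_assoc, lift_fst, ha,
        inv_mul_cancel])
  refine ⟨(a, b), ?_, ?_⟩
  · apply pt_ext
    intro S d t
    apply ext1
    intro S' s e
    simp only [← Category.assoc, comp_lift]
    rw [val, hb, MonObj.comp_mul, GrpObj.comp_inv, comp_at, comp_at, lift_fst_assoc, lift_snd,
      lift_snd_assoc, mul_inv_cancel_left, ← Category.assoc, comp_lift, lift_snd, lift_fst_assoc,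
      lift_fst]
  · rintro ⟨a', b'⟩ h
    dsimp only at h
    have h1 : a' = a := by
      apply ext
      intro S s e
      rw [ha, h, val, at_zero _ (z1 e), mul_one]
    subst h1
    refine Prod.ext rfl ?_
    apply mul_cancel hG
    intro S s d e
    have v := val a' b' s d e
    rw [← h] at v
    rw [hb, MonObj.comp_mul, GrpObj.comp_inv, comp_at, comp_at, lift_fst_assoc, lift_snd,
      lift_snd_assoc, ← Category.assoc, comp_lift, lift_snd, lift_fst_assoc,
      lift_fst, v, inv_mul_cancel_left]

end

end Tan

/-- The Lie algebra of a Lie group: the tangent space at `1`. -/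
abbrev LieGrp.lie {k : Type w} [CommRing k] {R : E} [CommRingObj R] [AlgObj k R] [KockLawvere k R]
    (G : LieGrp k R) : LieAlg k R where
  X := Tan R G.X
  comm := Tan.comm_add G.microlinear
  smul_add := Tan.smul_add'
  add_smul := Tan.add_smul' G.microlinear
  euclidean := Tan.euclidean G.microlinear
  bracket := Tan.bracket G.microlinear
  add_bracket := Tan.add_bracket G.microlinear
  bracket_add := Tan.bracket_add G.microlinear
  smul_bracket := Tan.smul_bracket G.microlinear
  bracket_smul := Tan.bracket_smul G.microlinear
  antisymm := Tan.bracket_antisymm G.microlinear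
  jacobi := Tan.jacobi G.microlinear
  microlinear := microlinear_ptd _ _ G.microlinear

/-! ### The Lie algebra of pointed maps into a Lie algebra -/

namespace LieAlg

variable {k : Type w} [CommRing k] {R : E} [CommRingObj R] [AlgObj k R] (L : LieAlg k R)
  {U : E} (u₀ : 𝟙_ E ⟶ U)

lemma smul_zero {T : E} (r : T ⟶ R) : r • (0 : T ⟶ L.X) = 0 := by
  have h := L.smul_add r (0 : T ⟶ L.X) 0
  rw [add_zero] at h
  exact left_eq_add.1 h

lemma zero_bracket {T : E} (x : T ⟶ L.X) : lift 0 x ≫ L.bracket = 0 := by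
  have h := L.add_bracket (0 : T ⟶ L.X) 0 x
  rw [add_zero] at h
  exact left_eq_add.1 h

/-- For a Lie algebra `L` and a pointed object `(U, u₀)`: `{f ∈ L ^ U | f(u₀) = 0}`. -/
abbrev PtdX : E := Ptd u₀ ζ[L.X]

/-- The constant map with value zero. -/
def zeroP : 𝟙_ E ⟶ L.PtdX u₀ := name 0 (by rw [AddMonObj.comp_zero]; rfl)

variable {u₀} in
lemma base_unc0 {T : E} (f : T ⟶ L.PtdX u₀) : base u₀ T ≫ unc f = 0 := base_unc f

/-- Pointwise addition. -/
def addP : L.PtdX u₀ ⊗ L.PtdX u₀ ⟶ L.PtdX u₀ :=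
  name (unc (fst _ _) + unc (snd _ _)) (by
    rw [AddMonObj.comp_add, base_unc0, base_unc0, add_zero]; rfl)

/-- The pointwise opposite. -/
def negP : L.PtdX u₀ ⟶ L.PtdX u₀ :=
  name (-unc (𝟙 _)) (by
    have e : base u₀ (L.PtdX u₀) ≫ (-unc (𝟙 _)) = -(base u₀ (L.PtdX u₀) ≫ unc (𝟙 _)) :=
      AddGrpObj.comp_neg _ _
    rw [e, base_unc0, neg_zero]; rfl)

/-- Pointwise scalar multiplication. -/
def smulP : R ⊗ L.PtdX u₀ ⟶ L.PtdX u₀ :=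
  name ((snd _ _ ≫ fst _ _) • unc (snd _ _)) (by
    rw [ModObj.comp_smul, base_unc0, smul_zero]; rfl)

/-- The pointwise bracket. -/
def bracketP : L.PtdX u₀ ⊗ L.PtdX u₀ ⟶ L.PtdX u₀ :=
  name (lift (unc (fst _ _)) (unc (snd _ _)) ≫ L.bracket) (by
    rw [← Category.assoc, comp_lift, base_unc0, zero_bracket]; rfl)

variable {u₀}

lemma unc_zeroP {T : E} (s : T ⟶ 𝟙_ E) : unc (s ≫ L.zeroP u₀) = 0 := by
  rw [unc_comp, zeroP, unc_name, AddMonObj.comp_zero]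

lemma unc_addP {T : E} (s : T ⟶ L.PtdX u₀ ⊗ L.PtdX u₀) :
    unc (s ≫ L.addP u₀) = unc (s ≫ fst _ _) + unc (s ≫ snd _ _) := by
  rw [unc_comp, addP, unc_name, AddMonObj.comp_add, ← unc_comp, ← unc_comp]

lemma unc_negP {T : E} (s : T ⟶ L.PtdX u₀) : unc (s ≫ L.negP u₀) = -unc s := by
  have e : U ◁ s ≫ (-unc (𝟙 (L.PtdX u₀))) = -(U ◁ s ≫ unc (𝟙 _)) := AddGrpObj.comp_neg _ _
  rw [unc_comp, negP, unc_name, e, ← unc_comp, Category.comp_id]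

lemma unc_smulP {T : E} (s : T ⟶ R ⊗ L.PtdX u₀) :
    unc (s ≫ L.smulP u₀) = (snd U T ≫ s ≫ fst _ _) • unc (s ≫ snd _ _) := by
  rw [unc_comp, smulP, unc_name, ModObj.comp_smul, ← unc_comp, whiskerLeft_snd_assoc]

lemma unc_bracketP {T : E} (s : T ⟶ L.PtdX u₀ ⊗ L.PtdX u₀) :
    unc (s ≫ L.bracketP u₀) = lift (unc (s ≫ fst _ _)) (unc (s ≫ snd _ _)) ≫ L.bracket := by
  rw [unc_comp, bracketP, unc_name, ← Category.assoc, comp_lift, ← unc_comp, ← unc_comp]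

/-- The pointwise addition. -/
instance : AddGrpObj (L.PtdX u₀) where
  zero := L.zeroP u₀
  add := L.addP u₀
  neg := L.negP u₀
  zero_add := unc_inj (by
    rw [unc_addP, whiskerRight_fst, whiskerRight_snd, unc_zeroP, zero_add, leftUnitor_hom])
  add_zero := unc_inj (by
    rw [unc_addP, whiskerLeft_fst, whiskerLeft_snd, unc_zeroP, add_zero, rightUnitor_hom])
  add_assoc := unc_inj (by
    rw [← Category.assoc, unc_addP, unc_addP]
    simp only [whiskerRight_fst, whiskerRight_snd, Category.assoc, whiskerLeft_fst,
      whiskerLeft_snd]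
    rw [unc_addP, ← Category.assoc, unc_addP]
    simp [add_assoc])
  left_neg := unc_inj (by
    rw [unc_addP, lift_fst, lift_snd, unc_zeroP, ← Category.id_comp (L.negP u₀), unc_negP,
      neg_add_cancel])
  right_neg := unc_inj (by
    rw [unc_addP, lift_fst, lift_snd, unc_zeroP, ← Category.id_comp (L.negP u₀), unc_negP,
      add_neg_cancel])

lemma unc_zero {T : E} : unc (0 : T ⟶ L.PtdX u₀) = 0 := by
  rw [Hom.zero_def]
  exact L.unc_zeroP _

lemma unc_add {T : E} (x y : T ⟶ L.PtdX u₀) : unc (x + y) = unc x + unc y := by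
  rw [Hom.add_def]
  exact (L.unc_addP (lift x y)).trans (by rw [lift_fst, lift_snd])

lemma unc_neg {T : E} (x : T ⟶ L.PtdX u₀) : unc (-x) = -unc x := by
  rw [Hom.neg_def]
  exact L.unc_negP x

/-- The pointwise action of the line. -/
instance : ModObj R (L.PtdX u₀) where
  smul := L.smulP u₀
  one_smul := unc_inj (by
    change unc (η ▷ L.PtdX u₀ ≫ L.smulP u₀) = unc (λ_ (L.PtdX u₀)).hom
    rw [unc_smulP, whiskerRight_fst, whiskerRight_snd, ← Category.assoc,
      toUnit_unique (snd U _ ≫ fst _ _) (toUnit _), ← Hom.one_def, one_smul, leftUnitor_hom])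
  mul_smul := unc_inj (by
    change unc (μ ▷ L.PtdX u₀ ≫ L.smulP u₀) =
      unc ((α_ R R (L.PtdX u₀)).hom ≫ R ◁ L.smulP u₀ ≫ L.smulP u₀)
    have e : unc ((α_ R R (L.PtdX u₀)).hom ≫ R ◁ L.smulP u₀ ≫ L.smulP u₀) =
        unc (((α_ R R (L.PtdX u₀)).hom ≫ R ◁ L.smulP u₀) ≫ L.smulP u₀) := by
      rw [Category.assoc]
    have e2 : ((α_ R R (L.PtdX u₀)).hom ≫ R ◁ L.smulP u₀) ≫ snd _ _ =
        ((α_ R R (L.PtdX u₀)).hom ≫ snd _ _) ≫ L.smulP u₀ := by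
      simp only [Category.assoc, whiskerLeft_snd]
    rw [e, unc_smulP, unc_smulP, e2, unc_smulP, smul_smul]
    simp only [Category.assoc, whiskerRight_fst, whiskerRight_snd, whiskerLeft_fst,
      associator_hom_fst, associator_hom_snd_fst, associator_hom_snd_snd]
    congr 1
    rw [Hom.mul_def, ← Category.assoc, ← Category.assoc]
    congr 1
    ext <;> simp)

lemma unc_smul {T : E} (r : T ⟶ R) (x : T ⟶ L.PtdX u₀) :
    unc (r • x) = (snd U T ≫ r) • unc x := by
  rw [Hom.smul_def]
  exact (L.unc_smulP (lift r x)).trans (by rw [lift_fst, lift_snd])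

lemma unc_bracket {T : E} (x y : T ⟶ L.PtdX u₀) :
    unc (lift x y ≫ L.bracketP u₀) = lift (unc x) (unc y) ≫ L.bracket := by
  rw [unc_bracketP, lift_fst, lift_snd]

lemma euclideanP {T : E} (f : D R 1 ⊗ T ⟶ L.PtdX u₀) :
    ∃! p : (T ⟶ L.PtdX u₀) × (T ⟶ L.PtdX u₀),
    f = snd (D R 1) T ≫ p.1 + (fst (D R 1) T ≫ incl R 1) • (snd (D R 1) T ≫ p.2) := by
  have conv : ∀ p : (T ⟶ L.PtdX u₀) × (T ⟶ L.PtdX u₀),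
      swap _ _ _ ≫ unc (snd (D R 1) T ≫ p.1 + (fst (D R 1) T ≫ incl R 1) •
        (snd (D R 1) T ≫ p.2)) = snd (D R 1) (U ⊗ T) ≫ unc p.1 +
        (fst (D R 1) (U ⊗ T) ≫ incl R 1) • (snd (D R 1) (U ⊗ T) ≫ unc p.2) := by
    intro p
    rw [unc_add, unc_smul, AddMonObj.comp_add, ModObj.comp_smul, unc_comp, unc_comp]
    have e1 : swap (D R 1) U T ≫ U ◁ snd (D R 1) T = snd _ _ := by
      rw [swap]; ext <;> simp
    have e2 : swap (D R 1) U T ≫ snd U _ ≫ fst (D R 1) T = fst _ _ := by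
      rw [swap]; simp
    have e3 : swap (D R 1) U T ≫ snd U _ ≫ fst (D R 1) T ≫ incl R 1 = fst _ _ ≫ incl R 1 := by
      rw [swap]; simp
    rw [e3, ← Category.assoc, ← Category.assoc, e1]
  obtain ⟨⟨a, b⟩, hf, hu⟩ := L.euclidean (swap _ _ _ ≫ unc f)
  dsimp only at hf
  have h0 : base u₀ T ≫ a = 0 ∧ base u₀ T ≫ b = 0 := by
    have e := (L.euclidean (0 : D R 1 ⊗ T ⟶ L.X)).unique (y₁ := (base u₀ T ≫ a, base u₀ T ≫ b))
      (y₂ := (0, 0)) (by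
        dsimp only
        have h := congrArg (fun g => D R 1 ◁ base u₀ T ≫ g) hf
        have h' : D R 1 ◁ base u₀ T ≫ swap (D R 1) U T ≫ unc f = 0 := by
          rw [← L.base_unc0 f, ← Category.assoc]
          congr 1
          rw [swap]
          ext <;> simp
        rw [h', AddMonObj.comp_add, ModObj.comp_smul, whiskerLeft_snd_assoc,
          whiskerLeft_snd_assoc, whiskerLeft_fst_assoc] at h
        exact h) (by
        dsimp only
        rw [AddMonObj.comp_zero, smul_zero, add_zero])
    exact ⟨(Prod.ext_iff.1 e).1, (Prod.ext_iff.1 e).2⟩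
  have inj : ∀ {g : D R 1 ⊗ T ⟶ L.PtdX u₀}, swap _ _ _ ≫ unc f = swap _ _ _ ≫ unc g → f = g := by
    intro g h
    apply unc_inj
    have := congrArg (fun h => swap U (D R 1) T ≫ h) h
    simpa only [← Category.assoc, swap_swap, Category.id_comp] using this
  refine ⟨(name a h0.1, name b h0.2), ?_, ?_⟩
  · apply inj
    rw [conv, unc_name, unc_name, hf]
  · intro p hp
    have := hu (unc p.1, unc p.2) (by
      dsimp only
      rw [← conv, ← hp])
    refine Prod.ext (unc_inj ?_) (unc_inj ?_)
    · rw [unc_name]; exact (Prod.ext_iff.1 this).1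
    · rw [unc_name]; exact (Prod.ext_iff.1 this).2

lemma comm_addP : IsCommAddMonObj (L.PtdX u₀) where
  add_comm := unc_inj (by
    change unc ((β_ _ _).hom ≫ L.addP u₀) = unc (L.addP u₀)
    have h1 : (β_ (L.PtdX u₀) (L.PtdX u₀)).hom ≫ fst _ _ = snd _ _ := by simp
    have h2 : (β_ (L.PtdX u₀) (L.PtdX u₀)).hom ≫ snd _ _ = fst _ _ := by simp
    rw [unc_addP, h1, h2, add_comm, ← Category.id_comp (L.addP u₀), unc_addP, Category.id_comp,
      Category.id_comp])

end LieAlg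

/-- For a Lie algebra `L` and a pointed object `(U, u₀)`, the Lie algebra
`{f ∈ L ^ U | f(u₀) = 0}`, with the pointwise operations. -/
abbrev LieAlg.ptd {k : Type w} [CommRing k] {R : E} [CommRingObj R] [AlgObj k R] (L : LieAlg k R)
    {U : E} (u₀ : 𝟙_ E ⟶ U) : LieAlg k R where
  X := L.PtdX u₀
  comm := L.comm_addP
  smul_add r x y := unc_inj (by simp only [unc_add, unc_smul, L.smul_add])
  add_smul r s x := unc_inj (by simp only [unc_add, unc_smul, AddMonObj.comp_add, L.add_smul])
  euclidean := L.euclideanP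
  bracket := L.bracketP u₀
  add_bracket x y z := unc_inj (by simp only [unc_add, unc_bracket, L.add_bracket])
  bracket_add x y z := unc_inj (by simp only [unc_add, unc_bracket, L.bracket_add])
  smul_bracket r x y := unc_inj (by simp only [unc_smul, unc_bracket, L.smul_bracket])
  bracket_smul r x y := unc_inj (by simp only [unc_smul, unc_bracket, L.bracket_smul])
  antisymm x y := unc_inj (by simp only [unc_neg, unc_bracket, ← L.antisymm])
  jacobi x y z := unc_inj (by simp only [unc_zero, unc_add, unc_bracket, L.jacobi])
  microlinear := microlinear_ptd _ _ L.microlinear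

end

end SDG

namespace SDG

set_option linter.unusedSectionVars false

noncomputable section

section

/-! ### Exchange of two variables, base points and change of stage -/

variable {E : Type u} [Category.{v} E] [CartesianMonoidalCategory E] [BraidedCategory E]
  [HasFiniteLimits E] [MonoidalClosed E]

/-! Let `(U, u₀)` be any pointed object; the theorem is the case of `D_n` pointed at `0`. Uncurried
twice, a tangent vector at stage `T` of the group of pointed maps `U → G` is a function `h(x)(u)` of
`x ∈ D`, `u ∈ U` and a parameter in `T`, with values in `G`. It is subject to two conditions: it is
`1` at `x = 0`, because the neutral element of that group is the constant map `1`, and it is `1` at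
`u = u₀`, because its values are pointed maps. A pointed map from `U` to the tangent space of `G`
uncurries to a function on the same variables in the other order, subject to the same two
conditions, since the zero tangent vector is the constant `1`. Exchanging `x` and `u` is therefore a
bijection whose inverse is again an exchange, and it is natural in the stage, hence an isomorphism
of objects by Yoneda.

The structure is compared through values: by `LieGrp.at_ap_exch`, evaluating the exchanged element
at `u` and then at `d` gives `h(d)(u)`. Both sums have as values the product in `G` of the values of
the summands, because multiplication of pointed maps is pointwise. Both scalar actions rescale the
variable in `D` and leave `u` alone.

The bracket needs more (`LieGrp.exch_bracket`), since no formula gives its value at a general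
element of `D`; only its values at products `d d'` are known, where it is a commutator. Evaluation
at `u` is a group homomorphism, so it carries the commutator of pointed maps to the commutator in
`G`, and the two brackets agree at all products `d d'`. Microlinearity of `G` makes this sufficient:
a tangent vector of `G` is determined by its values at products (`Tan.mul_cancel`). -/

/-- A base point inserted in the outer variable becomes, after the exchange, a base point in the
inner one. Together with `whisker_base_swap_assoc`, which does the opposite, this makes the two
pointedness conditions trade places. -/
lemma base_swap_assoc {A B T M : E} (a : 𝟙_ E ⟶ A) (f : B ⊗ (A ⊗ T) ⟶ M) :
    base a (B ⊗ T) ≫ swap A B T ≫ f = B ◁ base a T ≫ f := by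
  rw [← Category.assoc]
  congr 1
  apply pt_ext
  intro S b t
  rw [swap]
  ext <;> simp

lemma whisker_base_swap_assoc {A B T M : E} (b : 𝟙_ E ⟶ B) (f : B ⊗ (A ⊗ T) ⟶ M) :
    A ◁ base b T ≫ swap A B T ≫ f = base b (A ⊗ T) ≫ f := by
  rw [← Category.assoc]
  congr 1
  rw [swap]
  ext <;> simp

/-- The exchange does not touch the parameter; this is the source of the naturality of `LieGrp.exch`
and `LieGrp.exchInv` in the stage. -/
lemma whisker_swap_assoc {A B S T M : E} (s : S ⟶ T) (f : B ⊗ (A ⊗ T) ⟶ M) :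
    A ◁ B ◁ s ≫ swap A B T ≫ f = swap A B S ≫ B ◁ A ◁ s ≫ f := by
  simp only [← Category.assoc]
  congr 1
  rw [swap, swap]
  ext <;> simp

/-! ### Values of products and inverses of pointed maps into a group -/

section

variable {U : E} {u₀ : 𝟙_ E ⟶ U} {G : E} [GrpObj G]

lemma PtdGrp.unc_eq_one {T : E} : unc (1 : T ⟶ PtdGrp u₀ G) = 1 := by
  rw [Hom.one_def]
  exact PtdGrp.unc_one _

/-- This is where additive and multiplicative base points meet: vanishing in the tangent space means
being constantly `1` in `G`. The composite with `ζ` is the shape in which the condition at `u₀`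
appears for pointed maps into the Lie algebra. -/
lemma Tan.un_eq_one {R : E} [CommRingObj R] {T : E} (s : T ⟶ 𝟙_ E) :
    Tan.un (s ≫ ζ[Tan R G]) = 1 := by
  change Tan.un (s ≫ Tan.zero R G) = 1
  rw [Tan.un_comp, Tan.zero, Tan.un_mk, MonObj.comp_one]

/-- The operations are pointwise, so evaluation at `u` is a group homomorphism. With `PtdGrp.ap_inv`
this is what transports commutators. -/
lemma PtdGrp.ap_mul {T : E} (f g : T ⟶ PtdGrp u₀ G) (u : T ⟶ U) :
    ap (f * g) u = ap f u * ap g u := by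
  have h : unc (f * g) = unc f * unc g := by
    rw [Hom.mul_def]
    exact (PtdGrp.unc_mul (lift f g)).trans (by rw [lift_fst, lift_snd])
  rw [ap, h, MonObj.comp_mul]
  rfl

lemma PtdGrp.ap_inv {T : E} (f : T ⟶ PtdGrp u₀ G) (u : T ⟶ U) :
    ap f⁻¹ u = (ap f u)⁻¹ := by
  have h : unc f⁻¹ = (unc f)⁻¹ := by
    rw [Hom.inv_def]
    exact PtdGrp.unc_inv f
  rw [ap, h, GrpObj.comp_inv]
  rfl

end

/-! ### Values of the operations on pointed maps into a Lie algebra -/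

section

variable {k : Type w} [CommRing k] {R : E} [CommRingObj R] [AlgObj k R] (L : LieAlg k R)
  {U : E} {u₀ : 𝟙_ E ⟶ U}

lemma LieAlg.ap_add {T : E} (x y : T ⟶ L.PtdX u₀) (u : T ⟶ U) :
    ap (x + y) u = ap x u + ap y u := by
  rw [ap, L.unc_add, AddMonObj.comp_add]
  rfl

/-- The scalar comes from the stage and is constant along `U`: it acts through the projection `U × T
⟶ T`, and restricting to the graph of `u` gives it back unchanged. -/
lemma LieAlg.ap_smul {T : E} (r : T ⟶ R) (x : T ⟶ L.PtdX u₀) (u : T ⟶ U) :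
    ap (r • x) u = r • ap x u := by
  rw [ap, L.unc_smul, ModObj.comp_smul, lift_snd_assoc, Category.id_comp]
  rfl

lemma LieAlg.ap_bracket {T : E} (x y : T ⟶ L.PtdX u₀) (u : T ⟶ U) :
    ap (lift x y ≫ L.bracketP u₀) u = lift (ap x u) (ap y u) ≫ L.bracket := by
  rw [ap, L.unc_bracket, ← Category.assoc, comp_lift]
  rfl

end

/-! ### The exchange isomorphism for an arbitrary pointed object -/

section

variable {k : Type w} [CommRing k] {R : E} [CommRingObj R] [AlgObj k R] [KockLawvere k R]
  (G : LieGrp k R) {U : E} {u₀ : 𝟙_ E ⟶ U}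

/-- Extensionality for functions of two variables, obtained from extensionality in `u` followed by
extensionality in `d`. It reduces linearity of the exchange to identities between elements of `G`.
-/
lemma LieGrp.lie_ptd_ext {T : E} {f g : T ⟶ G.lie.PtdX u₀}
    (h : ∀ (S : E) (s : S ⟶ T) (u : S ⟶ U) (d : S ⟶ D R 1),
      Tan.at' (ap (s ≫ f) u) d = Tan.at' (ap (s ≫ g) u) d) : f = g := by
  apply ptd_ext
  intro S s u
  apply Tan.ext
  intro S' s' d
  -- The point `u` lives at stage `S` and `d` only at the later stage `S'`; pulling `u` back along
  -- `s'` brings both to the same stage.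
  rw [comp_ap, comp_ap, ← Category.assoc, ← Category.assoc, h]

/-- The exchange of variables from tangent vectors of `{f ∈ G ^ U | f(u₀) = 1}` to pointed maps
into the tangent space of `G`. -/
def LieGrp.exch {T : E} (h : T ⟶ Tan R (PtdGrp u₀ G.X)) : T ⟶ G.lie.PtdX u₀ :=
  name (Tan.mk (swap _ _ _ ≫ unc (Tan.un h)) (by
    -- Condition at `x = 0`: there `h` is the neutral pointed map, which is `1` at every `u`. Hence
    -- each `u` yields a tangent vector of `G`.
    rw [base_swap_assoc, ← unc_comp, Tan.base_un, PtdGrp.unc_eq_one])) (Tan.un_inj (by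
    -- Condition at `u = u₀`: every pointed map is `1` there, whatever `x` is, so the tangent vector
    -- at `u₀` is zero.
    rw [Tan.un_comp, Tan.un_mk, whisker_base_swap_assoc, base_unc]
    exact (Tan.un_eq_one _).symm))

/-- The exchange of variables from pointed maps into the tangent space of `G` to tangent vectors
of `{f ∈ G ^ U | f(u₀) = 1}`. -/
def LieGrp.exchInv {T : E} (f : T ⟶ G.lie.PtdX u₀) : T ⟶ (G.ptd u₀).lie.X :=
  Tan.mk (name (swap _ _ _ ≫ Tan.un (unc f)) (by
    -- The same two conditions in the opposite order: `f(u₀)` is the zero tangent vector, so for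
    -- each `x` the function of `u` is a pointed map.
    rw [base_swap_assoc, ← Tan.un_comp, base_unc]
    exact Tan.un_eq_one _)) (unc_inj (by
    -- Each `f(u)` is `1` at `x = 0`, so the pointed map over `x = 0` is the neutral one.
    rw [unc_comp, unc_name, whisker_base_swap_assoc, Tan.base_un, PtdGrp.unc_eq_one]))

/-- Both uncurryings are injective, so this equation determines the exchanged element; naturality,
invertibility and the formula for values are read off from it. -/
lemma LieGrp.un_unc_exch {T : E} (h : T ⟶ Tan R (PtdGrp u₀ G.X)) :
    Tan.un (unc (G.exch h)) = swap _ _ _ ≫ unc (Tan.un h) := by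
  rw [exch, unc_name, Tan.un_mk]

lemma LieGrp.unc_un_exchInv {T : E} (f : T ⟶ G.lie.PtdX u₀) :
    unc (Tan.un (G.exchInv f)) = swap _ _ _ ≫ Tan.un (unc f) := by
  rw [exchInv, Tan.un_mk, unc_name]

/-- Naturality in the stage, which makes the family of maps `exch` come from a single morphism of
objects. -/
lemma LieGrp.comp_exch {S T : E} (s : S ⟶ T) (h : T ⟶ Tan R (PtdGrp u₀ G.X)) :
    s ≫ G.exch h = G.exch (s ≫ h) := by
  apply unc_inj
  apply Tan.un_inj
  rw [un_unc_exch, unc_comp, Tan.un_comp, un_unc_exch, Tan.un_comp, unc_comp, whisker_swap_assoc]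

lemma LieGrp.comp_exchInv {S T : E} (s : S ⟶ T) (f : T ⟶ G.lie.PtdX u₀) :
    s ≫ G.exchInv f = G.exchInv (s ≫ f) := by
  apply Tan.un_inj
  apply unc_inj
  rw [unc_un_exchInv, Tan.un_comp, unc_comp, unc_un_exchInv, unc_comp, Tan.un_comp,
    whisker_swap_assoc]

/-- The Yoneda principle: the morphism representing the exchange is its value at the generic element
`𝟙 _`. -/
lemma LieGrp.exch_eq {T : E} (h : T ⟶ Tan R (PtdGrp u₀ G.X)) :
    h ≫ G.exch (u₀ := u₀) (𝟙 _) = G.exch h := by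
  rw [comp_exch, Category.comp_id]

lemma LieGrp.exch_exchInv {T : E} (f : T ⟶ G.lie.PtdX u₀) : G.exch (G.exchInv f) = f := by
  apply unc_inj
  apply Tan.un_inj
  rw [un_unc_exch, unc_un_exchInv, ← Category.assoc, swap_swap, Category.id_comp]

lemma LieGrp.exchInv_exch {T : E} (h : T ⟶ Tan R (PtdGrp u₀ G.X)) : G.exchInv (G.exch h) = h := by
  apply Tan.un_inj
  apply unc_inj
  rw [unc_un_exchInv, un_unc_exch, ← Category.assoc, swap_swap, Category.id_comp]

/-- The exchange in terms of elements, `e(h)(u)(d) = h(d)(u)`; the compatibility with each operation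
rests on it. -/
lemma LieGrp.at_ap_exch {T : E} (h : T ⟶ Tan R (PtdGrp u₀ G.X)) (u : T ⟶ U) (d : T ⟶ D R 1) :
    Tan.at' (ap (G.exch h) u) d = ap (Tan.at' h d) u := by
  rw [ap, Tan.at_comp, un_unc_exch, lift_swap_assoc, Tan.at', ap_comp]

lemma LieGrp.exch_add {T : E} (x y : T ⟶ Tan R (PtdGrp u₀ G.X)) :
    G.exch (x + y) = G.exch x + G.exch y :=
  G.lie_ptd_ext fun S s u d => by
    rw [AddMonObj.comp_add, comp_exch, comp_exch, comp_exch, AddMonObj.comp_add, LieAlg.ap_add,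
      Tan.at_add, at_ap_exch, at_ap_exch, at_ap_exch, Tan.at_add, PtdGrp.ap_mul]

/-- Both sides have the value `x(r d)(u)`; the group law of `G` plays no role. -/
lemma LieGrp.exch_smul {T : E} (r : T ⟶ R) (x : T ⟶ Tan R (PtdGrp u₀ G.X)) :
    G.exch (r • x) = r • G.exch x :=
  G.lie_ptd_ext fun S s u d => by
    rw [ModObj.comp_smul, comp_exch, comp_exch, ModObj.comp_smul, LieAlg.ap_smul,
      Tan.at_smul, at_ap_exch, at_ap_exch, Tan.at_smul]

/-- Each bracket is known only through its values at products in `D`, which are commutators in the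
group of pointed maps on one side and in `G` on the other. Evaluation at `u` matches them. -/
lemma LieGrp.exch_bracket {T : E} (x y : T ⟶ Tan R (PtdGrp u₀ G.X)) :
    G.exch (lift x y ≫ Tan.bracket (k := k) (G.ptd u₀).microlinear) =
      lift (G.exch x) (G.exch y) ≫ G.lie.bracketP u₀ := by
  apply ptd_ext
  intro S s u
  -- For fixed `u` both sides are tangent vectors of `G`, so microlinearity of `G` allows comparing
  -- them at elements `d d'` only. This replaces `LieGrp.lie_ptd_ext`, which would ask for arbitrary
  -- elements of `D`.
  apply Tan.mul_cancel G.microlinear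
  intro S' s' d d'
  simp only [comp_ap, comp_exch, ← Category.assoc, comp_lift]
  -- The commutator formula is used once for the group of pointed maps and once for `G`. With
  -- inverses in place of values at `-d`, the rest is that evaluation at `u` preserves products and
  -- inverses.
  rw [LieAlg.ap_bracket, at_ap_exch, Tan.at_bracket', Tan.at_bracket', at_ap_exch, at_ap_exch,
    PtdGrp.ap_mul, PtdGrp.ap_mul, PtdGrp.ap_mul, PtdGrp.ap_inv, PtdGrp.ap_inv]

/-- The Lie algebra of `{f ∈ G ^ U | f(u₀) = 1}` is the Lie algebra of pointed maps from `U` to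
the Lie algebra of `G`. -/
def LieGrp.lieExch (u₀ : 𝟙_ E ⟶ U) : LieAlg.Iso (G.ptd u₀).lie (G.lie.ptd u₀) where
  iso :=
    { hom := G.exch (𝟙 _)
      inv := G.exchInv (𝟙 _)
      hom_inv_id := by
        -- By naturality of the inverse exchange, the composite is `exchInv` applied to the exchange
        -- of the generic element.
        rw [comp_exchInv, Category.comp_id, exchInv_exch]
      inv_hom_id := (G.exch_eq _).trans (G.exch_exchInv _) }
  -- For each operation, `exch_eq` replaces composition with the representing morphism by `exch`
  -- itself, on the result and on the arguments.
  map_add x y := (G.exch_eq _).trans <| (G.exch_add x y).trans <|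
    (congrArg₂ (· + ·) (G.exch_eq x) (G.exch_eq y)).symm
  map_smul r x := (G.exch_eq _).trans <| (G.exch_smul r x).trans <|
    (congrArg (r • ·) (G.exch_eq x)).symm
  map_bracket x y := (G.exch_eq _).trans <| (G.exch_bracket x y).trans <|
    (congrArg₂ (fun a b => lift a b ≫ G.lie.bracketP u₀) (G.exch_eq x) (G.exch_eq y)).symm

end

end

end

end SDG

/-! ### The case of `D_n` pointed at `0` -/

theorem corollary3p1p1 {E : Type u} [Category.{v} E] [CartesianMonoidalCategory E]
    [BraidedCategory E] [HasFiniteLimits E] [MonoidalClosed E]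
    (k : Type w) [CommRing k] (R : E) [CommRingObj R] [SDG.AlgObj k R] [SDG.KockLawvere k R]
    (G : SDG.LieGrp k R) (n : ℕ) :
    ∃ e : SDG.LieAlg.Iso (G.ptd (SDG.zeroD R n)).lie (G.lie.ptd (SDG.zeroD R n)),
      ∀ (T : E) (h : T ⟶ (G.ptd (SDG.zeroD R n)).lie.X),
        SDG.Tan.un (SDG.unc (h ≫ e.iso.hom)) =
          SDG.swap (SDG.D R 1) (SDG.D R n) T ≫ SDG.unc (SDG.Tan.un h) := by
  -- The remaining equation says that this isomorphism is the one given by the exponential law. It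
  -- is `un_unc_exch`, once composition with the isomorphism is rewritten as the exchange of `h`.
  refine ⟨G.lieExch (SDG.zeroD R n), fun T h => ?_⟩
  rw [← G.un_unc_exch]
  exact congrArg (fun f => SDG.Tan.un (SDG.unc f)) (G.exch_eq h)
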